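/- Let $r>1$ be an integer. For $\Delta>0$ consider the grid $x_l=y_l=l\Delta$, $l\in\mathbb Z$. For $j,i\in\mathbb Z$ and $k,w\in\{0,\dots,r-1\}$ let $\mathcal S_{k,w}=\{x_{j+k-r},\dots,x_{j+k}\}\times\{y_{i+w-r},\dots,y_{i+w}\}$ be the stencil, $\overline{\mathcal S}_{k,w}=[x_{j+k-r},x_{j+k}]\times[y_{i+w-r},y_{i+w}]$ the closed stencil box, and $P_{k,w}$ the polynomial of degree at most $r$ in each variable which interpolates a function $f$ on $\mathcal S_{k,w}$. Define the smoothness coefficients $$\beta_{k,w}=\sum_{\substack{0\le\alpha_1,\alpha_2\le r\\ \alpha_1+\alpha_2\ge 2}}\int_{x_{j-1}}^{x_j}\int_{y_{i-1}}^{y_i}\Delta^{2(\alpha_1-1)}\Delta^{2(\alpha_2-1)}\bigl(\partial_x^{\alpha_1}\partial_y^{\alpha_2}P_{k,w}(x,y)\bigr)^2\,dy\,dx .$$ Let $\Omega\subseteq\mathbb R^2$ be open, $f$ a real function continuous on $\Omega$, and $\Gamma\subseteq\Omega$ an embedded $C^1$ curve without end points in $\Omega$ (near each of its points it is the zero set of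 a $C^1$ function with nonvanishing gradient, so that it has two sides locally). Assume that $\Gamma$ is a singularity curve of $f$: at each $\xi\in\Gamma$ the gradient of $f$ has limits $\nabla^+f(\xi)$ and $\nabla^-f(\xi)$ from the two sides of $\Gamma$, and $\nabla^+f(\xi)-\nabla^-f(\xi)\neq 0$. Assume that $f$ is $C^2$ on $\Omega\setminus\Gamma$, that its second derivatives have limits from the two sides at each point of $\Gamma$, and that at each point of $\Omega\setminus\Gamma$ at least one second derivative of $f$ is not zero. Let $K\subseteq\Omega$ be compact. Then the following holds for all sufficiently small $\Delta$ and all $j,i\in\mathbb Z$, $k,w\in\{0,\dots,r-1\}$ with $\overline{\mathcal S}_{k,w}\subseteq K$; the constants and the bound on $\Delta$ do not depend on $\Delta,j,i,k,w$. (i) If $\Gamma\cap\overline{\mathcal S}_{k,w}=\emptyset$, then $\beta_{k,w}=O(\Delta^2)$: there is $C>0$, independent of the box, with $|\beta_{k,w}|\le C\Delta^2$. This order is exact: there is $c>0$ with $\beta_{k,w}\ge c\,\Delta^2$ if $K\cap\Gamma=\emptyset$; and, for arbitrary $K$ and every $\mu>0$, there is $c>0$ (depending on $\mu$) with $\beta_{k,w}\ge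 c\,\Delta^2$ for all boxes that do not meet $\Gamma$ and on which $\|D^2f\|\ge\mu$. (ii) If $\Gamma\cap\overline{\mathcal S}_{k,w}\ne\emptyset$, then $\beta_{k,w}=O(1)$: there is $C>0$, independent of the box, with $|\beta_{k,w}|\le C$. This order is exact unless $\Gamma$ merely grazes the boundary of the box: for every $\varepsilon>0$ there is $c>0$ (depending on $\varepsilon$) with $\beta_{k,w}\ge c$ for all boxes that contain a point of $\Gamma$ at distance at least $\varepsilon\Delta$ from the boundary of the box. -/

import Mathlib

open Set Filter Topology

noncomputable section

/-! ### Grid, stencil, tensor-product interpolation, smoothness coefficients -/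

/-- The `a`-th abscissa `x_{j+k-n+a}` (for `a = 0, …, n`) of the one-dimensional stencil
`{x_{j+k-n}, …, x_{j+k}}` of the uniform grid `x_l = l * h`, `l ∈ ℤ`. -/
def stencilNode (h : ℝ) (n : ℕ) (j : ℤ) (k a : ℕ) : ℝ :=
  ((j + (k : ℤ) - (n : ℤ) + (a : ℤ) : ℤ) : ℝ) * h

/-- The polynomial function of degree at most `n` in `x` and at most `m` in `y` which interpolates
`f` on the rectangular stencil `{x_{j+k-n}, …, x_{j+k}} × {y_{i+w-m}, …, y_{i+w}}`, where
`x_l = l * dx` and `y_l = l * dy`; it is written as a tensor product of Lagrange bases. -/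
def interpPoly (f : ℝ × ℝ → ℝ) (dx dy : ℝ) (n m : ℕ) (j i : ℤ) (k w : ℕ) (x y : ℝ) : ℝ :=
  ∑ a ∈ Finset.range (n + 1), ∑ b ∈ Finset.range (m + 1),
    f (stencilNode dx n j k a, stencilNode dy m i w b) *
      ((Lagrange.basis (Finset.range (n + 1)) (stencilNode dx n j k) a).eval x *
        (Lagrange.basis (Finset.range (m + 1)) (stencilNode dy m i w) b).eval y)

/-- The polynomial takes the values of `f` at the points of the stencil. -/
theorem interpPoly_stencilNode (f : ℝ × ℝ → ℝ) (dx dy : ℝ) (hdx : dx ≠ 0) (hdy : dy ≠ 0)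
    (n m : ℕ) (j i : ℤ) (k w a b : ℕ) (ha : a ≤ n) (hb : b ≤ m) :
    interpPoly f dx dy n m j i k w (stencilNode dx n j k a) (stencilNode dy m i w b) =
      f (stencilNode dx n j k a, stencilNode dy m i w b) := by
  have inj : ∀ (h : ℝ), h ≠ 0 → ∀ (N : ℕ) (J : ℤ) (K : ℕ) (s : Set ℕ),
      Set.InjOn (stencilNode h N J K) s := by
    intro h hh N J K s p _ q _ hpq
    have h1 := mul_right_cancel₀ hh hpq
    have h2 : (J + (K : ℤ) - (N : ℤ) + (p : ℤ) : ℤ) = J + (K : ℤ) - (N : ℤ) + (q : ℤ) := by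
      exact_mod_cast h1
    omega
  have ha' : a ∈ Finset.range (n + 1) := Finset.mem_range.2 (by omega)
  have hb' : b ∈ Finset.range (m + 1) := Finset.mem_range.2 (by omega)
  unfold interpPoly
  rw [Finset.sum_eq_single_of_mem a ha', Finset.sum_eq_single_of_mem b hb']
  · rw [Lagrange.eval_basis_self (inj dx hdx n j k _) ha',
      Lagrange.eval_basis_self (inj dy hdy m i w _) hb']
    simp
  · intro c _ hc
    rw [Lagrange.eval_basis_of_ne (v := stencilNode dy m i w) hc hb']
    simp
  · intro c _ hc
    refine Finset.sum_eq_zero fun d _ => ?_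
    rw [Lagrange.eval_basis_of_ne (v := stencilNode dx n j k) hc ha']
    simp

/-- The smoothness coefficient of `f` in the cell `[x_{j-1}, x_j] × [y_{i-1}, y_i]` for the stencil
with indices `k, w` and the scaling exponents `γ₁ α₁`, `γ₂ α₂`:
`∑_{α₁ ≤ n, α₂ ≤ m, |α| ≥ 2} ∫∫ dx^{γ₁} dy^{γ₂} (∂_x^{α₁} ∂_y^{α₂} P_{k,w}(x, y))² dy dx`. -/
def smoothnessCoeff (γ₁ γ₂ : ℕ → ℤ) (f : ℝ × ℝ → ℝ) (dx dy : ℝ) (n m : ℕ) (j i : ℤ)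
    (k w : ℕ) : ℝ :=
  ∑ α ∈ (Finset.range (n + 1) ×ˢ Finset.range (m + 1)).filter (fun α => 2 ≤ α.1 + α.2),
    ∫ x in (((j - 1 : ℤ) : ℝ) * dx)..((j : ℝ) * dx),
      ∫ y in (((i - 1 : ℤ) : ℝ) * dy)..((i : ℝ) * dy),
        dx ^ γ₁ α.1 * dy ^ γ₂ α.2 *
          (iteratedDeriv α.1
            (fun u => iteratedDeriv α.2 (fun v => interpPoly f dx dy n m j i k w u v) y) x) ^ 2

/-- The smoothness coefficient `β_{k,w}` on the square grid of mesh size `h`, with the same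
degree `r` in both variables and the exponents `γ_i = 2 (α_i - 1)`. -/
def squareBeta (f : ℝ × ℝ → ℝ) (r : ℕ) (h : ℝ) (j i : ℤ) (k w : ℕ) : ℝ :=
  smoothnessCoeff (fun a => 2 * ((a : ℤ) - 1)) (fun a => 2 * ((a : ℤ) - 1)) f h h r r j i k w

/-- The closed stencil box `[x_{j-r+k}, x_{j+k}] × [y_{i-r+w}, y_{i+w}]` on the square grid. -/
def stencilBox (r : ℕ) (h : ℝ) (j i : ℤ) (k w : ℕ) : Set (ℝ × ℝ) :=
  Icc (((j - (r : ℤ) + (k : ℤ) : ℤ) : ℝ) * h) (((j + (k : ℤ) : ℤ) : ℝ) * h) ×ˢ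
    Icc (((i - (r : ℤ) + (w : ℤ) : ℤ) : ℝ) * h) (((i + (w : ℤ) : ℤ) : ℝ) * h)

/-! ### Singularity curves -/

/-- `Γ ∩ U` is a regular `C¹` curve in the open set `U` given by the equation `g = 0`. By the
implicit function theorem, a set which has such an equation near each of its points is the same as
an embedded curve with `C¹` parametrizations of nonvanishing velocity. The curve divides `U` into
the two sides `{g > 0}` and `{g < 0}`. -/
structure IsCurveEquation (Γ U : Set (ℝ × ℝ)) (g : ℝ × ℝ → ℝ) : Prop where
  isOpen : IsOpen U
  contDiffOn : ContDiffOn ℝ 1 g U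
  fderiv_ne_zero : ∀ p ∈ U, fderiv ℝ g p ≠ 0
  mem_iff : ∀ p ∈ U, (p ∈ Γ ↔ g p = 0)

/-- `F` has the limits `a` and `b` at `ξ` from the two sides of the curve `g = 0` in `U`. -/
def HasSideLimits {E : Type*} [TopologicalSpace E] (U : Set (ℝ × ℝ)) (g : ℝ × ℝ → ℝ)
    (F : ℝ × ℝ → E) (ξ : ℝ × ℝ) (a b : E) : Prop :=
  Tendsto F (𝓝[{p ∈ U | 0 < g p}] ξ) (𝓝 a) ∧ Tendsto F (𝓝[{p ∈ U | g p < 0}] ξ) (𝓝 b)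

/-- `Γ` is a `C¹` singularity curve of `f`: it is a `C¹` curve, near each of its points `f` is `C¹`
off `Γ`, and the gradient (here: the differential) of `f` has limits from the two sides of `Γ`,
whose difference, the jump of the gradient, is not zero. -/
def IsSingularityCurve (f : ℝ × ℝ → ℝ) (Γ : Set (ℝ × ℝ)) : Prop :=
  ∀ ξ ∈ Γ, ∃ (U : Set (ℝ × ℝ)) (g : ℝ × ℝ → ℝ), ξ ∈ U ∧ IsCurveEquation Γ U g ∧
    ContDiffOn ℝ 1 f (U \ Γ) ∧
    ∃ dp dm : ℝ × ℝ →L[ℝ] ℝ, HasSideLimits U g (fderiv ℝ f) ξ dp dm ∧ dp - dm ≠ 0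

/-- `f` is `C²` in `Ω` off the curve `Γ`, up to the curve from both sides: the second derivatives
have limits at each point of `Γ` from the two sides of `Γ`. -/
def IsRegularOff (f : ℝ × ℝ → ℝ) (Ω Γ : Set (ℝ × ℝ)) : Prop :=
  (∀ p ∈ Ω \ Γ, ContDiffAt ℝ 2 f p) ∧
  ∀ ξ ∈ Γ, ∃ (U : Set (ℝ × ℝ)) (g : ℝ × ℝ → ℝ), ξ ∈ U ∧ IsCurveEquation Γ U g ∧
    ∃ hp hm : ℝ × ℝ →L[ℝ] ℝ × ℝ →L[ℝ] ℝ, HasSideLimits U g (fderiv ℝ (fderiv ℝ f)) ξ hp hm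

end

/-! The weights are chosen so that rescaling to mesh size one turns the smoothness coefficient into
`h⁻²` times a quadratic form `gridForm r k w` of the `(r+1)²` nodal values
(`squareBeta_eq_gridForm`). For given `r` only `r²` such forms occur. Each is a sum of integrals of
squared derivatives of order at least two of a polynomial over a unit cell. It is therefore bounded
by a constant times the squared maximum of the data (`exists_gridForm_le`), and for `r ≥ 2` its
kernel consists exactly of the affine data (`exists_affine_of_gridForm_eq_zero`). What matters is
how far the nodal values are from being affine.

On a small box that misses `Γ`, Taylor's formula gives an affine part, plus `h²` times the values of
a fixed quadratic form, plus an error at most a small multiple of `h²`. The form is then of order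
`h⁴` and the coefficient of order `h²`. The lower bound holds because a nonzero quadratic form is
not affine on the nodes (`not_affine_quadData`).

At `Γ` the function is continuous, so the jump of the gradient is conormal (`exists_sub_eq_smul`),
and `f` is an affine function plus `c * max 0 n` for a linear form `n ≠ 0`, up to a small multiple
of `h` (`IsSingularityCurve.exists_kink`). The form is then of order `h²` and the coefficient of
order one. A kink whose line passes through the interior of the box is not affine on the nodes
(`not_affine_kinkData`). The kinks centred at distance at least `ε` from the boundary of the
rescaled box form a compact family, which makes the lower bound uniform.

Errors are absorbed by `half_gridForm_sub_le`. The local models hold near each point of `K`, and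
compactness of `K` makes the constants global (`exists_uniform_of_local`). -/

section

/-! ### Rescaling to the unit grid -/

open Polynomial

/-- The Lagrange basis polynomials of the nodes `0, …, r`. -/
noncomputable def refBasis (r a : ℕ) : ℝ[X] :=
  Lagrange.basis (Finset.range (r + 1)) (fun n : ℕ => (n : ℝ)) a

/-- The derivative `∂_x^{α₁} ∂_y^{α₂}` of the polynomial interpolating the data `F` on
`{0, …, r}²`. -/
noncomputable def gridDeriv (r : ℕ) (α : ℕ × ℕ) (F : ℕ → ℕ → ℝ) (s t : ℝ) : ℝ :=
  ∑ a ∈ Finset.range (r + 1), ∑ b ∈ Finset.range (r + 1),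
    F a b * ((derivative^[α.1] (refBasis r a)).eval s * (derivative^[α.2] (refBasis r b)).eval t)

/-- The indices of the derivatives which enter the smoothness coefficients. -/
def derivIndices (r : ℕ) : Finset (ℕ × ℕ) :=
  (Finset.range (r + 1) ×ˢ Finset.range (r + 1)).filter (fun α => 2 ≤ α.1 + α.2)

/-- The smoothness coefficient of the data `F` on the grid of mesh size one. -/
noncomputable def gridForm (r k w : ℕ) (F : ℕ → ℕ → ℝ) : ℝ :=
  ∑ α ∈ derivIndices r,
    ∫ s in ((r : ℝ) - k - 1)..((r : ℝ) - k), ∫ t in ((r : ℝ) - w - 1)..((r : ℝ) - w),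
      gridDeriv r α F s t ^ 2

/-- Each factor of a Lagrange basis polynomial is a quotient of differences, hence invariant under
the affine change of variable which carries the stencil to `0, …, r`. -/
theorem eval_basis_stencilNode (h : ℝ) (hh : h ≠ 0) (r : ℕ) (j : ℤ) (k a : ℕ) (x : ℝ) :
    (Lagrange.basis (Finset.range (r + 1)) (stencilNode h r j k) a).eval x =
      (refBasis r a).eval (x / h - ((j : ℝ) + k - r)) := by
  unfold refBasis Lagrange.basis Lagrange.basisDivisor
  rw [eval_prod, eval_prod]
  refine Finset.prod_congr rfl fun b hb => ?_
  have hab : (a : ℝ) - b ≠ 0 := by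
    rw [sub_ne_zero]
    exact_mod_cast (Finset.ne_of_mem_erase hb).symm
  have e : stencilNode h r j k a - stencilNode h r j k b = ((a : ℝ) - b) * h := by
    unfold stencilNode; push_cast; ring
  have e' : x - stencilNode h r j k b = (x / h - ((j : ℝ) + k - r) - b) * h := by
    unfold stencilNode; push_cast; field_simp; ring
  simp only [eval_mul, eval_C, eval_sub, eval_X]
  rw [e, e', mul_inv]
  field_simp

theorem iteratedDeriv_eval_div_sub (p : ℝ[X]) (h d : ℝ) (n : ℕ) :
    iteratedDeriv n (fun x => p.eval (x / h - d)) =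
      fun x => (h⁻¹) ^ n * (derivative^[n] p).eval (x / h - d) := by
  induction n with
  | zero => simp
  | succ n ih =>
    rw [iteratedDeriv_succ, ih]
    ext x
    have h1 : HasDerivAt (fun x : ℝ => x / h - d) h⁻¹ x := by
      simpa using ((hasDerivAt_id x).div_const h).sub_const d
    have h2 := (((derivative^[n] p).hasDerivAt (x / h - d)).comp x h1).const_mul ((h⁻¹) ^ n)
    rw [Function.iterate_succ_apply']
    refine h2.deriv.trans ?_
    ring

theorem iteratedDeriv_interpPoly (f : ℝ × ℝ → ℝ) (h : ℝ) (hh : h ≠ 0) (r : ℕ) (j i : ℤ)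
    (k w : ℕ) (α : ℕ × ℕ) (x y : ℝ) :
    iteratedDeriv α.1
      (fun u => iteratedDeriv α.2 (fun v => interpPoly f h h r r j i k w u v) y) x =
    (h⁻¹) ^ α.1 * (h⁻¹) ^ α.2 *
      gridDeriv r α (fun a b => f (stencilNode h r j k a, stencilNode h r i w b))
        (x / h - ((j : ℝ) + k - r)) (y / h - ((i : ℝ) + w - r)) := by
  set F : ℕ → ℕ → ℝ := fun a b => f (stencilNode h r j k a, stencilNode h r i w b) with hF
  have inner : ∀ u, iteratedDeriv α.2 (fun v => interpPoly f h h r r j i k w u v) y =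
      (∑ a ∈ Finset.range (r + 1), C ((h⁻¹) ^ α.2 * ∑ b ∈ Finset.range (r + 1), F a b *
        (derivative^[α.2] (refBasis r b)).eval (y / h - ((i : ℝ) + w - r))) * refBasis r a).eval
          (u / h - ((j : ℝ) + k - r)) := by
    intro u
    have e : (fun v => interpPoly f h h r r j i k w u v) = fun v =>
        (∑ a ∈ Finset.range (r + 1), ∑ b ∈ Finset.range (r + 1),
          C (F a b * (refBasis r a).eval (u / h - ((j : ℝ) + k - r))) * refBasis r b).eval
            (v / h - ((i : ℝ) + w - r)) := by
      ext v
      simp only [interpPoly, eval_finsetSum, eval_mul, eval_C, eval_basis_stencilNode h hh]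
      refine Finset.sum_congr rfl fun a _ => Finset.sum_congr rfl fun b _ => ?_
      ring
    rw [e, iteratedDeriv_eval_div_sub]
    simp only [iterate_derivative_sum, iterate_derivative_C_mul, eval_finsetSum, eval_mul, eval_C,
      Finset.mul_sum, Finset.sum_mul]
    refine Finset.sum_congr rfl fun a _ => Finset.sum_congr rfl fun b _ => ?_
    ring
  rw [funext inner, iteratedDeriv_eval_div_sub]
  simp only [iterate_derivative_sum, iterate_derivative_C_mul, eval_finsetSum, eval_mul, eval_C,
    Finset.mul_sum, Finset.sum_mul, gridDeriv]
  refine Finset.sum_congr rfl fun a _ => Finset.sum_congr rfl fun b _ => ?_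
  ring

/-- The weights contribute `h ^ (2 α₁ + 2 α₂ - 4)`, the squared derivative `h ^ (-2 α₁ - 2 α₂)` and
the area element `h ^ 2`, so every `α` gets the same factor `h ^ (-2)`. The node `x_j` has index `r
- k` in its stencil, which gives the new limits of integration. -/
theorem squareBeta_eq_gridForm (f : ℝ × ℝ → ℝ) (r : ℕ) (h : ℝ) (hh : 0 < h) (j i : ℤ)
    (k w : ℕ) :
    squareBeta f r h j i k w =
      (h ^ 2)⁻¹ *
        gridForm r k w (fun a b => f (stencilNode h r j k a, stencilNode h r i w b)) := by
  have hne := hh.ne'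
  unfold squareBeta smoothnessCoeff gridForm derivIndices
  rw [Finset.mul_sum]
  refine Finset.sum_congr rfl fun α _ => ?_
  simp only [iteratedDeriv_interpPoly f h hne]
  set G := gridDeriv r α (fun a b => f (stencilNode h r j k a, stencilNode h r i w b))
  have e : ∀ x y : ℝ, h ^ (2 * ((α.1 : ℤ) - 1)) * h ^ (2 * ((α.2 : ℤ) - 1)) *
      ((h⁻¹) ^ α.1 * (h⁻¹) ^ α.2 *
        G (x / h - ((j : ℝ) + k - r)) (y / h - ((i : ℝ) + w - r))) ^ 2 =
      (h ^ 4)⁻¹ * (G (x / h - ((j : ℝ) + k - r)) (y / h - ((i : ℝ) + w - r))) ^ 2 := by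
    intro x y
    have z : ∀ n : ℕ, h ^ (2 * ((n : ℤ) - 1)) = h ^ (2 * n) * (h ^ 2)⁻¹ := by
      intro n
      rw [show 2 * ((n : ℤ) - 1) = ((2 * n : ℕ) : ℤ) - ((2 : ℕ) : ℤ) by push_cast; ring,
        zpow_sub₀ hne, zpow_natCast, zpow_natCast]
      rfl
    rw [z, z, inv_pow, inv_pow]
    field_simp
    ring
  simp only [e]
  have inner : ∀ x : ℝ, (∫ y in (((i - 1 : ℤ) : ℝ) * h)..((i : ℝ) * h), (h ^ 4)⁻¹ *
      (G (x / h - ((j : ℝ) + k - r)) (y / h - ((i : ℝ) + w - r))) ^ 2) =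
      (h ^ 3)⁻¹ * ∫ t in ((r : ℝ) - w - 1)..((r : ℝ) - w),
        (G (x / h - ((j : ℝ) + k - r)) t) ^ 2 := by
    intro x
    rw [intervalIntegral.integral_const_mul,
      intervalIntegral.integral_comp_div_sub
        (fun t => (G (x / h - ((j : ℝ) + k - r)) t) ^ 2) hne, smul_eq_mul]
    have e1 : (((i - 1 : ℤ) : ℝ) * h) / h - ((i : ℝ) + w - r) = (r : ℝ) - w - 1 := by
      push_cast; field_simp; ring
    have e2 : ((i : ℝ) * h) / h - ((i : ℝ) + w - r) = (r : ℝ) - w := by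
      field_simp; ring
    rw [e1, e2]
    field_simp
  simp only [inner]
  rw [intervalIntegral.integral_const_mul,
    intervalIntegral.integral_comp_div_sub
      (fun s => ∫ t in ((r : ℝ) - w - 1)..((r : ℝ) - w), (G s t) ^ 2) hne, smul_eq_mul]
  have e1 : (((j - 1 : ℤ) : ℝ) * h) / h - ((j : ℝ) + k - r) = (r : ℝ) - k - 1 := by
    push_cast; field_simp; ring
  have e2 : ((j : ℝ) * h) / h - ((j : ℝ) + k - r) = (r : ℝ) - k := by
    field_simp; ring
  rw [e1, e2]
  field_simp

/-! ### Affine invariance and bounds of the quadratic form -/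

theorem sum_refBasis (r : ℕ) : ∑ a ∈ Finset.range (r + 1), refBasis r a = 1 :=
  Lagrange.sum_basis (Nat.cast_injective.injOn) ⟨0, by simp⟩

theorem sum_natCast_mul_refBasis (r : ℕ) (hr : 1 ≤ r) :
    ∑ a ∈ Finset.range (r + 1), C (a : ℝ) * refBasis r a = X := by
  have h := Lagrange.eq_interpolate (s := Finset.range (r + 1)) (v := fun n : ℕ => (n : ℝ))
    (f := (X : ℝ[X])) (Nat.cast_injective.injOn)
    (by rw [degree_X, Finset.card_range]; exact_mod_cast (by omega : 1 < r + 1))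
  rw [h, Lagrange.interpolate_apply]
  simp [refBasis]

theorem eval_refBasis_natCast (r a c : ℕ) (hc : c ≤ r) :
    (refBasis r a).eval (c : ℝ) = if a = c then 1 else 0 := by
  have hc' : c ∈ Finset.range (r + 1) := Finset.mem_range.2 (by omega)
  split_ifs with h
  · subst h
    exact Lagrange.eval_basis_self (v := fun n : ℕ => (n : ℝ)) (Nat.cast_injective.injOn) hc'
  · exact Lagrange.eval_basis_of_ne (v := fun n : ℕ => (n : ℝ)) h hc'

theorem sum_eval_iterate_derivative_refBasis (r n : ℕ) (s : ℝ) :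
    ∑ a ∈ Finset.range (r + 1), (derivative^[n] (refBasis r a)).eval s =
      (derivative^[n] (1 : ℝ[X])).eval s := by
  rw [← sum_refBasis r, iterate_derivative_sum, eval_finsetSum]

theorem sum_natCast_mul_eval_iterate_derivative_refBasis (r : ℕ) (hr : 1 ≤ r) (n : ℕ) (s : ℝ) :
    ∑ a ∈ Finset.range (r + 1), (a : ℝ) * (derivative^[n] (refBasis r a)).eval s =
      (derivative^[n] (X : ℝ[X])).eval s := by
  rw [← sum_natCast_mul_refBasis r hr, iterate_derivative_sum, eval_finsetSum]
  simp only [iterate_derivative_C_mul, eval_mul, eval_C]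

theorem gridDeriv_add (r : ℕ) (α : ℕ × ℕ) (F G : ℕ → ℕ → ℝ) (s t : ℝ) :
    gridDeriv r α (fun a b => F a b + G a b) s t = gridDeriv r α F s t + gridDeriv r α G s t := by
  simp only [gridDeriv, add_mul, Finset.sum_add_distrib]

theorem gridDeriv_mul_left (r : ℕ) (α : ℕ × ℕ) (c : ℝ) (F : ℕ → ℕ → ℝ) (s t : ℝ) :
    gridDeriv r α (fun a b => c * F a b) s t = c * gridDeriv r α F s t := by
  simp only [gridDeriv, Finset.mul_sum, mul_assoc]

/-- Interpolation of degree `r ≥ 1` reproduces `1` and `X` in each variable, so the interpolant of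
affine data is that affine function, whose derivatives of order at least two vanish. -/
theorem gridDeriv_affine (r : ℕ) (hr : 1 ≤ r) (α : ℕ × ℕ) (hα : 2 ≤ α.1 + α.2)
    (c₀ c₁ c₂ s t : ℝ) :
    gridDeriv r α (fun a b => c₀ + c₁ * a + c₂ * b) s t = 0 := by
  have e : gridDeriv r α (fun a b => c₀ + c₁ * a + c₂ * b) s t =
      c₀ * ((derivative^[α.1] (1 : ℝ[X])).eval s * (derivative^[α.2] (1 : ℝ[X])).eval t) +
      c₁ * ((derivative^[α.1] (X : ℝ[X])).eval s * (derivative^[α.2] (1 : ℝ[X])).eval t) +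
      c₂ * ((derivative^[α.1] (1 : ℝ[X])).eval s * (derivative^[α.2] (X : ℝ[X])).eval t) := by
    rw [← sum_eval_iterate_derivative_refBasis r, ← sum_eval_iterate_derivative_refBasis r,
      ← sum_natCast_mul_eval_iterate_derivative_refBasis r hr,
      ← sum_natCast_mul_eval_iterate_derivative_refBasis r hr]
    simp only [gridDeriv, Finset.sum_mul_sum]
    simp only [Finset.mul_sum, ← Finset.sum_add_distrib]
    refine Finset.sum_congr rfl fun a _ => Finset.sum_congr rfl fun b _ => ?_
    ring
  rw [e]
  have one : ∀ n, 1 ≤ n → derivative^[n] (1 : ℝ[X]) = 0 := fun n hn =>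
    iterate_derivative_one (by omega)
  have ex : ∀ n, 2 ≤ n → derivative^[n] (X : ℝ[X]) = 0 := fun n hn =>
    iterate_derivative_X (by omega)
  rcases Nat.lt_or_ge α.1 1 with h1 | h1
  · rw [one α.2 (by omega), ex α.2 (by omega)]; simp
  · rw [one α.1 h1]
    rcases Nat.lt_or_ge α.2 1 with h2 | h2
    · rw [ex α.1 (by omega)]; simp
    · rw [one α.2 h2]; simp

theorem continuous_gridDeriv {X : Type*} [TopologicalSpace X] (r : ℕ) (α : ℕ × ℕ)
    (F : X → ℕ → ℕ → ℝ) (hF : ∀ a b, Continuous fun x => F x a b) {s t : X → ℝ}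
    (hs : Continuous s) (ht : Continuous t) :
    Continuous fun x => gridDeriv r α (F x) (s x) (t x) := by
  unfold gridDeriv
  refine continuous_finsetSum _ fun a _ => continuous_finsetSum _ fun b _ => (hF a b).mul ?_
  exact ((Polynomial.continuous _).comp hs).mul ((Polynomial.continuous _).comp ht)

theorem continuous_gridForm {X : Type*} [TopologicalSpace X] (r k w : ℕ)
    (F : X → ℕ → ℕ → ℝ) (hF : ∀ a b, Continuous fun x => F x a b) :
    Continuous fun x => gridForm r k w (F x) := by
  unfold gridForm
  refine continuous_finsetSum _ fun α _ => ?_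
  refine intervalIntegral.continuous_parametric_intervalIntegral_of_continuous' (μ := MeasureTheory.volume) ?_ _ _
  refine intervalIntegral.continuous_parametric_intervalIntegral_of_continuous' (μ := MeasureTheory.volume) ?_ _ _
  exact (continuous_gridDeriv r α (fun x : (X × ℝ) × ℝ => F x.1.1)
    (fun a b => (hF a b).comp (continuous_fst.comp continuous_fst))
    (continuous_snd.comp continuous_fst) continuous_snd).pow 2

theorem continuous_gridDeriv_uncurry (r : ℕ) (α : ℕ × ℕ) (F : ℕ → ℕ → ℝ) :
    Continuous (Function.uncurry fun s t => gridDeriv r α F s t) :=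
  continuous_gridDeriv r α (fun _ : ℝ × ℝ => F) (fun _ _ => continuous_const) continuous_fst
    continuous_snd

theorem continuous_sq_gridDeriv (r : ℕ) (α : ℕ × ℕ) (F : ℕ → ℕ → ℝ) :
    Continuous (Function.uncurry fun s t => gridDeriv r α F s t ^ 2) :=
  (continuous_gridDeriv_uncurry r α F).pow 2

theorem integral_integral_mono {G H : ℝ → ℝ → ℝ} (hG : Continuous (Function.uncurry G))
    (hH : Continuous (Function.uncurry H)) (hGH : ∀ s t, G s t ≤ H s t) {a b c d : ℝ}
    (hab : a ≤ b) (hcd : c ≤ d) :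
    ∫ s in a..b, ∫ t in c..d, G s t ≤ ∫ s in a..b, ∫ t in c..d, H s t := by
  have hi : ∀ {G : ℝ → ℝ → ℝ}, Continuous (Function.uncurry G) → ∀ s, Continuous (G s) :=
    fun h s => h.comp (Continuous.prodMk continuous_const continuous_id)
  refine intervalIntegral.integral_mono_on hab ?_ ?_ fun s _ =>
    intervalIntegral.integral_mono_on hcd ((hi hG s).intervalIntegrable _ _)
      ((hi hH s).intervalIntegrable _ _) fun t _ => hGH s t
  · exact (intervalIntegral.continuous_parametric_intervalIntegral_of_continuous' hG _ _).intervalIntegrable _ _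
  · exact (intervalIntegral.continuous_parametric_intervalIntegral_of_continuous' hH _ _).intervalIntegrable _ _

theorem integral_integral_sq_nonneg (G : ℝ → ℝ → ℝ) {a b c d : ℝ}
    (hab : a ≤ b) (hcd : c ≤ d) : 0 ≤ ∫ s in a..b, ∫ t in c..d, G s t ^ 2 :=
  intervalIntegral.integral_nonneg hab fun _ _ =>
    intervalIntegral.integral_nonneg hcd fun _ _ => sq_nonneg _

theorem gridForm_nonneg (r k w : ℕ) (F : ℕ → ℕ → ℝ) : 0 ≤ gridForm r k w F :=
  Finset.sum_nonneg fun _ _ => integral_integral_sq_nonneg _ (by linarith) (by linarith)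

theorem gridForm_congr {r k w : ℕ} {F G : ℕ → ℕ → ℝ}
    (h : ∀ a ≤ r, ∀ b ≤ r, F a b = G a b) : gridForm r k w F = gridForm r k w G := by
  have e : ∀ α s t, gridDeriv r α F s t = gridDeriv r α G s t := fun α s t =>
    Finset.sum_congr rfl fun a ha => Finset.sum_congr rfl fun b hb => by
      rw [h a (by have := Finset.mem_range.1 ha; omega) b (by have := Finset.mem_range.1 hb; omega)]
  simp only [gridForm, e]

theorem gridForm_affine_add (r k w : ℕ) (hr : 1 ≤ r) (c₀ c₁ c₂ : ℝ) (F : ℕ → ℕ → ℝ) :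
    gridForm r k w (fun a b => c₀ + c₁ * a + c₂ * b + F a b) = gridForm r k w F := by
  unfold gridForm
  refine Finset.sum_congr rfl fun α hα => ?_
  have h2 : 2 ≤ α.1 + α.2 := (Finset.mem_filter.1 hα).2
  have e : ∀ s t, gridDeriv r α (fun a b => c₀ + c₁ * a + c₂ * b + F a b) s t =
      gridDeriv r α F s t := fun s t => by
    rw [gridDeriv_add r α (fun a b => c₀ + c₁ * a + c₂ * b) F, gridDeriv_affine r hr α h2,
      zero_add]
  simp only [e]

theorem gridForm_mul_left (r k w : ℕ) (c : ℝ) (F : ℕ → ℕ → ℝ) :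
    gridForm r k w (fun a b => c * F a b) = c ^ 2 * gridForm r k w F := by
  unfold gridForm
  simp only [gridDeriv_mul_left, mul_pow, intervalIntegral.integral_const_mul, Finset.mul_sum]

/-- This is `(u + v)² ≤ 2u² + 2v²` under the integral. -/
theorem gridForm_add_le (r k w : ℕ) (F E : ℕ → ℕ → ℝ) :
    gridForm r k w (fun a b => F a b + E a b) ≤ 2 * gridForm r k w F + 2 * gridForm r k w E := by
  unfold gridForm
  rw [Finset.mul_sum, Finset.mul_sum, ← Finset.sum_add_distrib]
  refine Finset.sum_le_sum fun α _ => ?_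
  have c1 := continuous_gridDeriv_uncurry r α F
  have c2 := continuous_gridDeriv_uncurry r α E
  have hi : ∀ {G : ℝ → ℝ → ℝ}, Continuous (Function.uncurry G) → ∀ s, Continuous (G s) :=
    fun h s => h.comp (Continuous.prodMk continuous_const continuous_id)
  have d1 : Continuous (Function.uncurry fun s t => 2 * gridDeriv r α F s t ^ 2) :=
    continuous_const.mul (c1.pow 2)
  have d2 : Continuous (Function.uncurry fun s t => 2 * gridDeriv r α E s t ^ 2) :=
    continuous_const.mul (c2.pow 2)
  calc _ ≤ ∫ s in ((r : ℝ) - k - 1)..((r : ℝ) - k), ∫ t in ((r : ℝ) - w - 1)..((r : ℝ) - w),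
      (2 * gridDeriv r α F s t ^ 2 + 2 * gridDeriv r α E s t ^ 2) := by
        refine integral_integral_mono ?_ ?_ (fun s t => ?_) (by linarith) (by linarith)
        · simp only [gridDeriv_add]
          exact (c1.add c2).pow 2
        · exact d1.add d2
        · rw [gridDeriv_add]
          nlinarith [sq_nonneg (gridDeriv r α F s t - gridDeriv r α E s t)]
    _ = _ := by
        have e : ∀ s, (∫ t in ((r : ℝ) - w - 1)..((r : ℝ) - w),
            (2 * gridDeriv r α F s t ^ 2 + 2 * gridDeriv r α E s t ^ 2)) =
            (∫ t in ((r : ℝ) - w - 1)..((r : ℝ) - w), 2 * gridDeriv r α F s t ^ 2) +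
            ∫ t in ((r : ℝ) - w - 1)..((r : ℝ) - w), 2 * gridDeriv r α E s t ^ 2 := fun s =>
          intervalIntegral.integral_add ((hi d1 s).intervalIntegrable _ _)
            ((hi d2 s).intervalIntegrable _ _)
        simp only [e]
        rw [intervalIntegral.integral_add]
        · simp only [intervalIntegral.integral_const_mul]
        · exact (intervalIntegral.continuous_parametric_intervalIntegral_of_continuous' d1 _ _).intervalIntegrable _ _
        · exact (intervalIntegral.continuous_parametric_intervalIntegral_of_continuous' d2 _ _).intervalIntegrable _ _

/-- The upper bound is applied to `F = (F + E) - E`. This is how the lower bounds survive the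
approximation of `f` by its local model. -/
theorem half_gridForm_sub_le (r k w : ℕ) (F E : ℕ → ℕ → ℝ) :
    gridForm r k w F / 2 - gridForm r k w E ≤ gridForm r k w (fun a b => F a b + E a b) := by
  have h := gridForm_add_le r k w (fun a b => F a b + E a b) (fun a b => (-1) * E a b)
  rw [gridForm_mul_left, gridForm_congr (G := F) (fun a _ b _ => by ring)] at h
  linarith

theorem exists_gridForm_le (r : ℕ) : ∃ C > 0, ∀ k < r, ∀ w < r, ∀ (F : ℕ → ℕ → ℝ) (M : ℝ),
    (∀ a ≤ r, ∀ b ≤ r, |F a b| ≤ M) → gridForm r k w F ≤ C * M ^ 2 := by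
  set Z : ℕ × ℕ → ℝ → ℝ → ℝ := fun α s t =>
    ∑ a ∈ Finset.range (r + 1), ∑ b ∈ Finset.range (r + 1),
      |(derivative^[α.1] (refBasis r a)).eval s * (derivative^[α.2] (refBasis r b)).eval t| with hZ
  have cZ : ∀ α, Continuous (Function.uncurry (Z α)) := fun α =>
    continuous_finsetSum _ fun a _ => continuous_finsetSum _ fun b _ =>
      (((Polynomial.continuous _).comp continuous_fst).mul
        ((Polynomial.continuous _).comp continuous_snd)).abs
  have cZM : ∀ α (M : ℝ), Continuous (Function.uncurry fun s t => Z α s t ^ 2 * M ^ 2) :=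
    fun α M => ((cZ α).pow 2).mul continuous_const
  set c : ℕ → ℕ → ℝ := fun k w => ∑ α ∈ derivIndices r,
    ∫ s in ((r : ℝ) - k - 1)..((r : ℝ) - k), ∫ t in ((r : ℝ) - w - 1)..((r : ℝ) - w),
      Z α s t ^ 2 with hc
  have c0 : ∀ k w, 0 ≤ c k w := fun k w =>
    Finset.sum_nonneg fun _ _ => integral_integral_sq_nonneg _ (by linarith) (by linarith)
  have key : ∀ k w (F : ℕ → ℕ → ℝ) (M : ℝ),
      (∀ a ≤ r, ∀ b ≤ r, |F a b| ≤ M) → gridForm r k w F ≤ c k w * M ^ 2 := by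
    intro k w F M hM
    have hM0 : 0 ≤ M := (abs_nonneg _).trans (hM 0 (by omega) 0 (by omega))
    simp only [hc, gridForm, Finset.sum_mul]
    refine Finset.sum_le_sum fun α _ => ?_
    have b1 : ∀ s t, |gridDeriv r α F s t| ≤ Z α s t * M := by
      intro s t
      simp only [hZ, gridDeriv, Finset.sum_mul]
      refine (Finset.abs_sum_le_sum_abs _ _).trans (Finset.sum_le_sum fun a ha => ?_)
      refine (Finset.abs_sum_le_sum_abs _ _).trans (Finset.sum_le_sum fun b hb => ?_)
      rw [abs_mul, mul_comm]
      refine mul_le_mul_of_nonneg_left (hM a ?_ b ?_) (abs_nonneg _)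
      · have := Finset.mem_range.1 ha; omega
      · have := Finset.mem_range.1 hb; omega
    have := integral_integral_mono (G := fun s t => gridDeriv r α F s t ^ 2)
      (H := fun s t => Z α s t ^ 2 * M ^ 2) (continuous_sq_gridDeriv r α F)
      (cZM α M)
      (fun s t => by
        rw [← mul_pow, ← sq_abs]
        exact pow_le_pow_left₀ (abs_nonneg _) (b1 s t) 2)
      (show (r : ℝ) - k - 1 ≤ r - k by linarith) (show (r : ℝ) - w - 1 ≤ r - w by linarith)
    simpa only [intervalIntegral.integral_mul_const] using this
  -- The sum over all `k, w` dominates each single constant, and the summand `1` makes it positive.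
  refine ⟨1 + ∑ k ∈ Finset.range r, ∑ w ∈ Finset.range r, c k w, ?_, fun k hk w hw F M hM => ?_⟩
  · have : 0 ≤ ∑ k ∈ Finset.range r, ∑ w ∈ Finset.range r, c k w :=
      Finset.sum_nonneg fun _ _ => Finset.sum_nonneg fun _ _ => c0 _ _
    linarith
  · refine (key k w F M hM).trans (mul_le_mul_of_nonneg_right ?_ (sq_nonneg M))
    have h1 := Finset.single_le_sum (f := fun w => c k w) (fun w _ => c0 k w)
      (Finset.mem_range.2 hw)
    have h2 := Finset.single_le_sum (f := fun k => ∑ w ∈ Finset.range r, c k w)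
      (fun k _ => Finset.sum_nonneg fun w _ => c0 k w) (Finset.mem_range.2 hk)
    linarith

/-! ### The kernel of the quadratic form and uniform lower bounds -/

theorem intervalIntegral_sq_eq_zero {G : ℝ → ℝ → ℝ} (hG : Continuous (Function.uncurry G))
    {a b c d : ℝ} (hab : a < b) (hcd : c < d)
    (h : ∫ s in a..b, ∫ t in c..d, G s t ^ 2 = 0) : ∀ s ∈ Icc a b, ∀ t ∈ Icc c d, G s t = 0 := by
  have hG2 : Continuous (Function.uncurry fun s t => G s t ^ 2) := hG.pow 2
  by_contra! hne
  obtain ⟨s, hs, t, ht, hst⟩ := hne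
  refine absurd h (ne_of_gt ?_)
  refine intervalIntegral.integral_pos hab
    (intervalIntegral.continuous_parametric_intervalIntegral_of_continuous' hG2 _ _).continuousOn
    (fun s _ => intervalIntegral.integral_nonneg hcd.le fun _ _ => sq_nonneg _) ⟨s, hs, ?_⟩
  exact intervalIntegral.integral_pos hcd
    (hG2.comp (Continuous.prodMk continuous_const continuous_id)).continuousOn
    (fun t _ => sq_nonneg _) ⟨t, ht, by positivity⟩

theorem Polynomial.eq_zero_of_eval_eq_zero_on_Icc {p : ℝ[X]} {a b : ℝ} (hab : a < b)
    (h : ∀ x ∈ Icc a b, p.eval x = 0) : p = 0 :=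
  p.eq_zero_of_infinite_isRoot ((Icc_infinite hab).mono h)

theorem Polynomial.eval_eq_of_derivative_derivative_eq_zero {p : ℝ[X]}
    (h : derivative (derivative p) = 0) (x : ℝ) :
    p.eval x = p.eval 0 + (derivative p).eval 0 * x := by
  have h1 := eq_C_of_derivative_eq_zero h
  set c := (derivative p).coeff 0
  have h2 : derivative (p - C c * X) = 0 := by simp [h1]
  have h3 := eq_C_of_derivative_eq_zero h2
  set d := (p - C c * X).coeff 0
  have h4 : p = C d + C c * X := by rw [← h3]; ring
  rw [h1, h4]
  simp

/-- With one variable frozen, a mixed derivative is a derivative of a polynomial in the other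
variable, so facts about univariate polynomials apply. -/
theorem gridDeriv_eq_eval_left (r : ℕ) (m n : ℕ) (F : ℕ → ℕ → ℝ) (s t : ℝ) :
    gridDeriv r (m, n) F s t = (derivative^[m] (∑ a ∈ Finset.range (r + 1),
      C (∑ b ∈ Finset.range (r + 1), F a b * (derivative^[n] (refBasis r b)).eval t) *
        refBasis r a)).eval s := by
  simp only [gridDeriv, iterate_derivative_sum, iterate_derivative_C_mul, eval_finsetSum, eval_mul,
    eval_C, Finset.sum_mul]
  refine Finset.sum_congr rfl fun a _ => Finset.sum_congr rfl fun b _ => ?_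
  ring

theorem gridDeriv_eq_eval_right (r : ℕ) (m n : ℕ) (F : ℕ → ℕ → ℝ) (s t : ℝ) :
    gridDeriv r (m, n) F s t = (derivative^[n] (∑ b ∈ Finset.range (r + 1),
      C (∑ a ∈ Finset.range (r + 1), F a b * (derivative^[m] (refBasis r a)).eval s) *
        refBasis r b)).eval t := by
  simp only [gridDeriv, iterate_derivative_sum, iterate_derivative_C_mul, eval_finsetSum, eval_mul,
    eval_C, Finset.sum_mul]
  rw [Finset.sum_comm]
  refine Finset.sum_congr rfl fun a _ => Finset.sum_congr rfl fun b _ => ?_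
  ring

theorem gridDeriv_natCast (r : ℕ) (F : ℕ → ℕ → ℝ) {a b : ℕ} (ha : a ≤ r) (hb : b ≤ r) :
    gridDeriv r (0, 0) F a b = F a b := by
  simp only [gridDeriv, Function.iterate_zero, id, eval_refBasis_natCast r _ _ ha,
    eval_refBasis_natCast r _ _ hb]
  rw [Finset.sum_eq_single_of_mem a (Finset.mem_range.2 (by omega)),
    Finset.sum_eq_single_of_mem b (Finset.mem_range.2 (by omega))]
  · simp
  · intro c _ hc; simp [hc]
  · intro c _ hc; simp [hc]

/-- The kernel of the quadratic form `gridForm` consists of the affine data. -/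
theorem exists_affine_of_gridForm_eq_zero {r k w : ℕ} (hr : 2 ≤ r) {F : ℕ → ℕ → ℝ}
    (h : gridForm r k w F = 0) :
    ∃ c₀ c₁ c₂ : ℝ, ∀ a ≤ r, ∀ b ≤ r, F a b = c₀ + c₁ * a + c₂ * b := by
  -- Each summand is nonnegative and the sum is zero, so every derivative involved vanishes on the
  -- cell. Being polynomial in `s` and in `t`, it vanishes on the whole plane, first for `t` in the
  -- cell and then for all `t`.
  have hz : ∀ m n, m ≤ r → n ≤ r → 2 ≤ m + n → ∀ s t, gridDeriv r (m, n) F s t = 0 := by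
    intro m n hm hn hmn
    have h1 := (Finset.sum_eq_zero_iff_of_nonneg (fun α _ =>
      integral_integral_sq_nonneg (gridDeriv r α F) (by linarith) (by linarith))).1 h (m, n)
      (Finset.mem_filter.2 ⟨Finset.mem_product.2 ⟨Finset.mem_range.2 (by simp; omega),
        Finset.mem_range.2 (by simp; omega)⟩, hmn⟩)
    have h2 := intervalIntegral_sq_eq_zero (continuous_gridDeriv_uncurry r (m, n) F)
      (by linarith) (by linarith) h1
    have h3 : ∀ s, ∀ t ∈ Icc ((r : ℝ) - w - 1) ((r : ℝ) - w), gridDeriv r (m, n) F s t = 0 := by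
      intro s t ht
      refine (gridDeriv_eq_eval_left r m n F s t).trans ?_
      refine (congrArg (eval s) (Polynomial.eq_zero_of_eval_eq_zero_on_Icc
        (show (r : ℝ) - k - 1 < r - k by linarith) fun s hs => ?_)).trans eval_zero
      exact (gridDeriv_eq_eval_left r m n F s t).symm.trans (h2 s hs t ht)
    intro s t
    refine (gridDeriv_eq_eval_right r m n F s t).trans ?_
    refine (congrArg (eval t) (Polynomial.eq_zero_of_eval_eq_zero_on_Icc
      (show (r : ℝ) - w - 1 < r - w by linarith) fun t ht => ?_)).trans eval_zero
    exact (gridDeriv_eq_eval_right r m n F s t).symm.trans (h3 s t ht)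
  have zero_of : ∀ p : ℝ[X], (∀ x, p.eval x = 0) → p = 0 := fun p hp =>
    Polynomial.eq_zero_of_eval_eq_zero_on_Icc zero_lt_one fun x _ => hp x
  -- Only the indices `(2, 0)`, `(0, 2)` and `(1, 1)` are needed: they make the interpolant affine
  -- in `s`, affine in `t` on the line `s = 0`, and free of a mixed term.
  have hx : ∀ s t, gridDeriv r (0, 0) F s t =
      gridDeriv r (0, 0) F 0 t + gridDeriv r (1, 0) F 0 t * s := by
    intro s t
    have e := Polynomial.eval_eq_of_derivative_derivative_eq_zero
      (zero_of _ fun x => (gridDeriv_eq_eval_left r 2 0 F x t).symm.trans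
        (hz 2 0 hr (by omega) le_rfl x t)) s
    rw [gridDeriv_eq_eval_left r 0 0 F, gridDeriv_eq_eval_left r 0 0 F,
      gridDeriv_eq_eval_left r 1 0 F]
    exact e
  have hy : ∀ t, gridDeriv r (0, 0) F 0 t =
      gridDeriv r (0, 0) F 0 0 + gridDeriv r (0, 1) F 0 0 * t := by
    intro t
    have e := Polynomial.eval_eq_of_derivative_derivative_eq_zero
      (zero_of _ fun x => (gridDeriv_eq_eval_right r 0 2 F 0 x).symm.trans
        (hz 0 2 (by omega) hr le_rfl 0 x)) t
    rw [gridDeriv_eq_eval_right r 0 0 F, gridDeriv_eq_eval_right r 0 0 F,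
      gridDeriv_eq_eval_right r 0 1 F]
    exact e
  have hxy : ∀ t, gridDeriv r (1, 0) F 0 t = gridDeriv r (1, 0) F 0 0 := by
    intro t
    have e := eq_C_of_derivative_eq_zero
      (zero_of _ fun x => (gridDeriv_eq_eval_right r 1 1 F 0 x).symm.trans
        (hz 1 1 (by omega) (by omega) le_rfl 0 x))
    rw [gridDeriv_eq_eval_right r 1 0 F, gridDeriv_eq_eval_right r 1 0 F]
    simp only [Function.iterate_zero, id]
    rw [e, eval_C, eval_C]
  refine ⟨gridDeriv r (0, 0) F 0 0, gridDeriv r (1, 0) F 0 0, gridDeriv r (0, 1) F 0 0, fun a ha b hb => ?_⟩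
  rw [← gridDeriv_natCast r F ha hb, hx, hy, hxy]
  ring

/-- A family of data without affine members which depends continuously on a parameter in a compact
set is uniformly nonaffine. -/
theorem exists_le_gridForm {X : Type*} [TopologicalSpace X] {K : Set X} (hK : IsCompact K) (r : ℕ)
    (hr : 2 ≤ r) (F : X → ℕ → ℕ → ℝ) (hF : ∀ a b, Continuous fun x => F x a b)
    (hne : ∀ x ∈ K, ¬ ∃ c₀ c₁ c₂ : ℝ, ∀ a ≤ r, ∀ b ≤ r, F x a b = c₀ + c₁ * a + c₂ * b) :
    ∃ m > 0, ∀ k < r, ∀ w < r, ∀ x ∈ K, m ≤ gridForm r k w (F x) := by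
  have h1 : ∀ k w, ∃ m > 0, ∀ x ∈ K, m ≤ gridForm r k w (F x) := by
    intro k w
    rcases K.eq_empty_or_nonempty with rfl | hne'
    · exact ⟨1, one_pos, by simp⟩
    obtain ⟨x, hx, hmin⟩ := hK.exists_isMinOn hne' (continuous_gridForm r k w F hF).continuousOn
    -- The minimum over `K` is attained, and a minimum equal to zero would be attained at affine
    -- data.
    refine ⟨gridForm r k w (F x), lt_of_le_of_ne (gridForm_nonneg _ _ _ _) fun h0 =>
      hne x hx (exists_affine_of_gridForm_eq_zero hr h0.symm), fun y hy => hmin hy⟩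
  -- All small positive `m` serve for a given pair `k, w`, hence some `m` serves for the finitely
  -- many pairs together.
  have h2 : ∀ᶠ m : ℝ in 𝓝[>] 0, ∀ k ∈ Finset.range r, ∀ w ∈ Finset.range r, ∀ x ∈ K,
      m ≤ gridForm r k w (F x) := by
    rw [Filter.eventually_all_finset]
    intro k _
    rw [Filter.eventually_all_finset]
    intro w _
    obtain ⟨m, hm, hle⟩ := h1 k w
    filter_upwards [Ioo_mem_nhdsGT hm] with c hc x hx using hc.2.le.trans (hle x hx)
  obtain ⟨m, hm, hm0⟩ := (h2.and self_mem_nhdsWithin).exists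
  exact ⟨m, hm0, fun k hk w hw => hm k (Finset.mem_range.2 hk) w (Finset.mem_range.2 hw)⟩

end

/-! ### One-sided derivatives and the kink along the curve -/

/-- Differentiability is required only inside the segment, because its end points may lie on the
curve. -/
theorem abs_image_sub_le_of_hasFDerivAt_segment {E : Type*} [NormedAddCommGroup E]
    [NormedSpace ℝ E] {G : E → ℝ} {G' : E → E →L[ℝ] ℝ} {x v : E} {η : ℝ}
    (hc : ∀ t ∈ Icc (0 : ℝ) 1, ContinuousAt G (x + t • v))
    (hd : ∀ t ∈ Ioo (0 : ℝ) 1, HasFDerivAt G (G' (x + t • v)) (x + t • v) ∧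
      ‖G' (x + t • v)‖ ≤ η) :
    |G (x + v) - G x| ≤ η * ‖v‖ := by
  have hline : ∀ t : ℝ, HasDerivAt (fun t : ℝ => x + t • v) v t := fun t => by
    simpa using ((hasDerivAt_id t).smul_const v).const_add x
  obtain ⟨t, ht, e⟩ := exists_hasDerivAt_eq_slope (fun t : ℝ => G (x + t • v))
    (fun t => G' (x + t • v) v) zero_lt_one
    (fun t ht => ((hc t ht).comp (f := fun t : ℝ => x + t • v)
      (hline t).continuousAt).continuousWithinAt)
    (fun t ht => (hd t ht).1.comp_hasDerivAt t (hline t))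
  simp only [one_smul, zero_smul, add_zero, sub_zero, div_one] at e
  rw [← e, ← Real.norm_eq_abs]
  exact (G' (x + t • v)).le_of_opNorm_le (hd t ht).2 v

theorem exists_apply_eq_one {E : Type*} [NormedAddCommGroup E] [NormedSpace ℝ E]
    {g' : E →L[ℝ] ℝ} (h : g' ≠ 0) : ∃ ν, g' ν = 1 := by
  obtain ⟨v, hv⟩ : ∃ v, g' v ≠ 0 := by
    by_contra! hc
    exact h (ContinuousLinearMap.ext hc)
  exact ⟨(g' v)⁻¹ • v, by simp [hv]⟩

/-- If the differential of `f` is close to `D` on the side `g > 0` of a regular hypersurface, then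
`f` is strictly differentiable with derivative `D` from this side, up to the boundary. -/
theorem exists_abs_sub_sub_le_on_side {E : Type*} [NormedAddCommGroup E] [NormedSpace ℝ E]
    {f g : E → ℝ} {g' D : E →L[ℝ] ℝ} {ξ : E} (hg : HasStrictFDerivAt g g' ξ) (hg' : g' ≠ 0)
    (hf : ∀ᶠ x in 𝓝 ξ, ContinuousAt f x)
    (hD : ∀ η > 0, ∀ᶠ x in 𝓝 ξ, 0 < g x → DifferentiableAt ℝ f x ∧ ‖fderiv ℝ f x - D‖ ≤ η)
    {η : ℝ} (hη : 0 < η) :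
    ∃ ρ > 0, ∀ x ∈ Metric.ball ξ ρ, ∀ y ∈ Metric.ball ξ ρ, 0 ≤ g x → 0 ≤ g y →
      |f y - f x - D (y - x)| ≤ η * ‖y - x‖ := by
  obtain ⟨ν, hν⟩ := exists_apply_eq_one hg'
  set N := ‖ν‖ with hN
  have hN0 : 0 ≤ N := norm_nonneg ν
  -- The segment from `x` to `y` may cross the hypersurface. It is replaced by a path which climbs
  -- by `s • ν` with `s = L * ‖y - x‖`, runs parallel to `y - x` and descends to `y`. The choice of
  -- `L` and `κ` keeps `g` positive along this path, except possibly at its ends. Its length is at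
  -- most `(2 * L * N + 1) * ‖y - x‖`, hence the tolerance `η / (2 * L * N + 1)` for the
  -- differential.
  set Gn := ‖g'‖ with hGn
  have hGn0 : 0 ≤ Gn := norm_nonneg g'
  set L := 2 * Gn + 3 with hL
  have hL0 : 0 < L := by positivity
  set κ := 1 / (2 * (N + 1)) with hκ
  have hκ0 : 0 < κ := by positivity
  have hκN : κ * N ≤ 1 / 2 := by
    rw [hκ, div_mul_eq_mul_div, div_le_div_iff₀ (by positivity) (by positivity)]; linarith
  have hκ1 : κ ≤ 1 := by
    rw [hκ, div_le_one (by positivity)]; linarith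
  have hM : 0 < 2 * L * N + 1 := by positivity
  have hstrict : ∀ᶠ q : E × E in 𝓝 (ξ, ξ), ‖g q.1 - g q.2 - g' (q.1 - q.2)‖ ≤ κ * ‖q.1 - q.2‖ :=
    hg.isLittleO.def hκ0
  rw [nhds_prod_eq] at hstrict
  obtain ⟨r₁, hr₁, h₁⟩ := Metric.eventually_nhds_iff_ball.1
    (hf.and (hD (η / (2 * L * N + 1)) (by positivity)))
  rw [← nhds_prod_eq] at hstrict
  obtain ⟨r₂, hr₂, h₂⟩ := Metric.eventually_nhds_iff_ball.1 hstrict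
  set R := min r₁ r₂ with hR
  have hR0 : 0 < R := lt_min hr₁ hr₂
  have hball : ∀ x ∈ Metric.ball ξ R, ContinuousAt f x ∧
      (0 < g x → DifferentiableAt ℝ f x ∧ ‖fderiv ℝ f x - D‖ ≤ η / (2 * L * N + 1)) :=
    fun x hx => h₁ x (Metric.ball_subset_ball (min_le_left _ _) hx)
  have hgrow : ∀ x ∈ Metric.ball ξ R, ∀ w, x + w ∈ Metric.ball ξ R →
      g x + g' w - κ * ‖w‖ ≤ g (x + w) := by
    intro x hx w hw
    have := h₂ (x + w, x) (by
      rw [← ball_prod_same]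
      exact ⟨Metric.ball_subset_ball (min_le_right _ _) hw,
        Metric.ball_subset_ball (min_le_right _ _) hx⟩)
    simp only [add_sub_cancel_left, Real.norm_eq_abs] at this
    have := (abs_le.1 this).1
    linarith
  -- Points of the path are within `(L * N + 1) * ‖y - x‖` of `x` or `y`, and `‖y - x‖` is less than
  -- twice the new radius, so the path stays in the ball of radius `R`.
  refine ⟨R / (2 * L * N + 3), by positivity, fun x hx y hy gx gy => ?_⟩
  set ρ := R / (2 * L * N + 3) with hρ
  have hρR : ρ * (2 * L * N + 3) = R := by rw [hρ]; field_simp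
  rw [mem_ball_iff_norm] at hx hy
  set d := ‖y - x‖ with hd
  rcases (norm_nonneg (y - x)).eq_or_lt with h0 | h0
  · have : y - x = 0 := norm_eq_zero.1 h0.symm
    have hyx : y = x := sub_eq_zero.1 this
    subst hyx
    simp [hd]
  have hdρ : d < 2 * ρ := by
    have : d ≤ ‖y - ξ‖ + ‖x - ξ‖ := by
      rw [hd, show y - x = (y - ξ) - (x - ξ) by abel]; exact norm_sub_le _ _
    linarith
  have hmem : ∀ z, ‖z - ξ‖ < ρ → ∀ w, ‖w‖ ≤ (L * N + 1) * d → z + w ∈ Metric.ball ξ R := by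
    intro z hz w hw
    rw [mem_ball_iff_norm]
    have h3 : ‖z + w - ξ‖ ≤ ‖z - ξ‖ + ‖w‖ := by
      rw [show z + w - ξ = (z - ξ) + w by abel]; exact norm_add_le _ _
    have h4 : (L * N + 1) * d ≤ (L * N + 1) * (2 * ρ) :=
      mul_le_mul_of_nonneg_left hdρ.le (by positivity)
    rw [← hρR]
    nlinarith
  have hmem0 : ∀ z, ‖z - ξ‖ < ρ → z ∈ Metric.ball ξ R := fun z hz => by
    simpa using hmem z hz 0 (by rw [norm_zero]; positivity)
  set s := L * d with hs
  have hs0 : 0 < s := by positivity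
  have hFd : ∀ z, z ∈ Metric.ball ξ R → 0 < g z →
      HasFDerivAt (fun z => f z - D z) (fderiv ℝ f z - D) z ∧
        ‖fderiv ℝ f z - D‖ ≤ η / (2 * L * N + 1) := fun z hz gz =>
    ⟨((hball z hz).2 gz).1.hasFDerivAt.sub D.hasFDerivAt, ((hball z hz).2 gz).2⟩
  have hFc : ∀ z, z ∈ Metric.ball ξ R → ContinuousAt (fun z => f z - D z) z := fun z hz =>
    (hball z hz).1.sub D.continuous.continuousAt
  -- Along the climb `g` grows at least at half the rate `g' ν = 1`, because `κ * N ≤ 1 / 2`.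
  have hup : ∀ z, ‖z - ξ‖ < ρ → 0 ≤ g z →
      |(f (z + s • ν) - D (z + s • ν)) - (f z - D z)| ≤ η / (2 * L * N + 1) * ‖s • ν‖ := by
    intro z hz gz
    have hin : ∀ t ∈ Icc (0 : ℝ) 1, z + t • s • ν ∈ Metric.ball ξ R := by
      intro t ht
      refine hmem z hz _ ?_
      rw [norm_smul, norm_smul, Real.norm_of_nonneg ht.1, Real.norm_of_nonneg hs0.le, ← hN]
      have : t * (s * N) ≤ 1 * (s * N) := mul_le_mul_of_nonneg_right ht.2 (by positivity)
      rw [hs] at this ⊢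
      nlinarith
    refine abs_image_sub_le_of_hasFDerivAt_segment (G := fun z => f z - D z)
      (G' := fun z => fderiv ℝ f z - D) (fun t ht => hFc _ (hin t ht)) fun t ht =>
      hFd _ (hin t ⟨ht.1.le, ht.2.le⟩) ?_
    have h5 := hgrow z (hmem0 z hz) _ (hin t ⟨ht.1.le, ht.2.le⟩)
    rw [norm_smul, norm_smul, Real.norm_of_nonneg ht.1.le, Real.norm_of_nonneg hs0.le, ← hN,
      map_smul, map_smul, hν] at h5
    simp only [smul_eq_mul, mul_one] at h5
    have h6 : 0 < t * s := mul_pos ht.1 hs0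
    have h7 : κ * (t * (s * N)) ≤ t * s * (1 / 2) := by
      calc κ * (t * (s * N)) = t * s * (κ * N) := by ring
        _ ≤ _ := mul_le_mul_of_nonneg_left hκN h6.le
    linarith
  -- Along the parallel piece the climb has raised `g` by about `s`, of which at most `s / 2 + (Gn +
  -- 1) * d` can be lost. This is less than `s` because `s = (2 * Gn + 3) * d`.
  have hacross : |(f (x + s • ν + (y - x)) - D (x + s • ν + (y - x))) -
      (f (x + s • ν) - D (x + s • ν))| ≤ η / (2 * L * N + 1) * ‖y - x‖ := by
    have hbd : ∀ t ∈ Icc (0 : ℝ) 1, ‖s • ν + t • (y - x)‖ ≤ s * N + d := by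
      intro t ht
      refine (norm_add_le _ _).trans ?_
      rw [norm_smul, norm_smul, Real.norm_of_nonneg ht.1, Real.norm_of_nonneg hs0.le, ← hN, ← hd]
      have : t * d ≤ 1 * d := mul_le_mul_of_nonneg_right ht.2 h0.le
      linarith
    have hin : ∀ t ∈ Icc (0 : ℝ) 1, x + s • ν + t • (y - x) ∈ Metric.ball ξ R := by
      intro t ht
      rw [add_assoc]
      refine hmem x hx _ ((hbd t ht).trans ?_)
      rw [hs]; linarith
    refine abs_image_sub_le_of_hasFDerivAt_segment (G := fun z => f z - D z)
      (G' := fun z => fderiv ℝ f z - D) (fun t ht => hFc _ (hin t ht)) fun t ht =>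
      hFd _ (hin t ⟨ht.1.le, ht.2.le⟩) ?_
    have ht' : t ∈ Icc (0 : ℝ) 1 := ⟨ht.1.le, ht.2.le⟩
    have h5 := hin t ht'
    rw [add_assoc] at h5 ⊢
    have h6 := hgrow x (hmem0 x hx) _ h5
    have h7 : κ * ‖s • ν + t • (y - x)‖ ≤ κ * (s * N + d) :=
      mul_le_mul_of_nonneg_left (hbd t ht') hκ0.le
    have h8 : s * (κ * N) ≤ s * (1 / 2) := mul_le_mul_of_nonneg_left hκN hs0.le
    have h9 : κ * d ≤ 1 * d := mul_le_mul_of_nonneg_right hκ1 h0.le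
    have h10 : |g' (t • (y - x))| ≤ Gn * d := by
      rw [← Real.norm_eq_abs]
      refine (g'.le_opNorm _).trans (mul_le_mul_of_nonneg_left ?_ hGn0)
      rw [norm_smul, Real.norm_of_nonneg ht'.1]
      exact mul_le_of_le_one_left h0.le ht'.2
    have h11 := (abs_le.1 h10).1
    rw [map_add, map_smul g' s, hν, smul_eq_mul, mul_one] at h6
    have h12 : s = 2 * (Gn * d) + 3 * d := by rw [hs, hL]; ring
    linarith
  have e1 := hup x hx gx
  have e2 := hup y hy gy
  rw [show x + s • ν + (y - x) = y + s • ν by abel] at hacross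
  rw [norm_smul, Real.norm_of_nonneg hs0.le, ← hN] at e1 e2
  rw [← hd] at hacross
  have e3 : f y - f x - D (y - x) = ((f (x + s • ν) - D (x + s • ν)) - (f x - D x)) +
      ((f (y + s • ν) - D (y + s • ν)) - (f (x + s • ν) - D (x + s • ν))) -
      ((f (y + s • ν) - D (y + s • ν)) - (f y - D y)) := by
    rw [map_sub]; ring
  rw [e3]
  refine (abs_sub _ _).trans ((add_le_add (abs_add_le _ _) le_rfl).trans ?_)
  calc _ ≤ η / (2 * L * N + 1) * (s * N) + η / (2 * L * N + 1) * d +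
      η / (2 * L * N + 1) * (s * N) := by linarith
    _ = η * d := by rw [hs]; field_simp; ring

/-- If `f` has the one-sided derivatives `dp` and `dm` on the two sides of a regular hypersurface
`g = 0`, then the jump `dp - dm` is conormal. -/
theorem exists_sub_eq_smul {E : Type*} [NormedAddCommGroup E] [NormedSpace ℝ E]
    {f g : E → ℝ} {g' dp dm : E →L[ℝ] ℝ} {ξ : E} (hg : HasStrictFDerivAt g g' ξ) (hg' : g' ≠ 0)
    (hξ : g ξ = 0) (hgc : ∀ᶠ x in 𝓝 ξ, ContinuousAt g x)
    (hp : ∀ η > 0, ∃ ρ > 0, ∀ x ∈ Metric.ball ξ ρ, ∀ y ∈ Metric.ball ξ ρ, 0 ≤ g x → 0 ≤ g y →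
      |f y - f x - dp (y - x)| ≤ η * ‖y - x‖)
    (hm : ∀ η > 0, ∃ ρ > 0, ∀ x ∈ Metric.ball ξ ρ, ∀ y ∈ Metric.ball ξ ρ, g x ≤ 0 → g y ≤ 0 →
      |f y - f x - dm (y - x)| ≤ η * ‖y - x‖) :
    ∃ c : ℝ, dp - dm = c • g' := by
  obtain ⟨ν, hν⟩ := exists_apply_eq_one hg'
  -- For a tangent vector `τ` there are points of the hypersurface close to `ξ + t • τ`. Both
  -- one-sided expansions hold there, so their difference forces `dp - dm` to be small on `τ`.
  have key : ∀ τ, g' τ = 0 → (dp - dm) τ = 0 := by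
    intro τ hτ
    set B := ‖τ‖ + ‖ν‖ with hB
    have hB0 : 0 ≤ B := by positivity
    have hbound : ∀ κ > 0, κ < 1 → |(dp - dm) τ| ≤ κ * (2 * B + |(dp - dm) ν|) := by
      intro κ hκ hκ1
      obtain ⟨r₁, hr₁, h₁⟩ := hp κ hκ
      obtain ⟨r₂, hr₂, h₂⟩ := hm κ hκ
      obtain ⟨r₃, hr₃, h₃⟩ := Metric.eventually_nhds_iff_ball.1
        (hgc.and (hg.hasFDerivAt.isLittleO.def (show 0 < κ / (B + 1) by positivity)))
      set R := min r₁ (min r₂ r₃) with hR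
      have hR0 : 0 < R := lt_min hr₁ (lt_min hr₂ hr₃)
      set t := R / (B + 1) with ht
      have ht0 : 0 < t := by positivity
      have htB : t * (B + 1) = R := by rw [ht]; field_simp
      have hn : ∀ σ ∈ Icc (-κ) κ, ‖t • (τ + σ • ν)‖ ≤ t * B := by
        intro σ hσ
        rw [norm_smul, Real.norm_of_nonneg ht0.le]
        refine mul_le_mul_of_nonneg_left ((norm_add_le _ _).trans ?_) ht0.le
        rw [norm_smul, Real.norm_eq_abs, hB]
        have : |σ| ≤ 1 := (abs_le.2 hσ).trans hκ1.le
        linarith [mul_le_of_le_one_left (norm_nonneg ν) this]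
      have hin : ∀ σ ∈ Icc (-κ) κ, ξ + t • (τ + σ • ν) ∈ Metric.ball ξ R := by
        intro σ hσ
        rw [mem_ball_iff_norm, add_sub_cancel_left]
        have := hn σ hσ
        nlinarith
      have hg3 : ∀ σ ∈ Icc (-κ) κ, |g (ξ + t • (τ + σ • ν)) - t * σ| < t * κ := by
        intro σ hσ
        have := (h₃ _ (Metric.ball_subset_ball
          ((min_le_right _ _).trans (min_le_right _ _)) (hin σ hσ))).2
        rw [hξ, add_sub_cancel_left, sub_zero, map_smul, map_add, map_smul, hτ, hν,
          Real.norm_eq_abs] at this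
        simp only [smul_eq_mul, mul_one, zero_add] at this
        refine this.trans_lt (lt_of_le_of_lt (mul_le_mul_of_nonneg_left (hn σ hσ)
          (by positivity)) ?_)
        rw [div_mul_eq_mul_div, div_lt_iff₀ (by positivity)]
        have : 0 < t * κ := by positivity
        nlinarith
      -- On `σ = -κ` and `σ = κ` the function `g` has opposite signs, since it differs from `t * σ`
      -- by less than `t * κ`.
      obtain ⟨σ, hσ, hgσ⟩ : ∃ σ ∈ Icc (-κ) κ, g (ξ + t • (τ + σ • ν)) = 0 := by
        have hcont : ContinuousOn (fun σ : ℝ => g (ξ + t • (τ + σ • ν))) (Icc (-κ) κ) := by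
          intro σ hσ
          refine (ContinuousAt.comp (f := fun σ : ℝ => ξ + t • (τ + σ • ν))
            (h₃ _ (Metric.ball_subset_ball ((min_le_right _ _).trans (min_le_right _ _))
              (hin σ hσ))).1 ?_).continuousWithinAt
          fun_prop
        have a1 := (abs_lt.1 (hg3 (-κ) ⟨le_rfl, by linarith⟩)).2
        have a2 := (abs_lt.1 (hg3 κ ⟨by linarith, le_rfl⟩)).1
        exact intermediate_value_Icc (by linarith) hcont ⟨by linarith, by linarith⟩
      have hx0 : ∀ r, 0 < r → ξ ∈ Metric.ball ξ r := fun r hr => Metric.mem_ball_self hr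
      have b1 := h₁ ξ (hx0 _ hr₁) _ (Metric.ball_subset_ball (min_le_left _ _) (hin σ hσ))
        hξ.ge hgσ.ge
      have b2 := h₂ ξ (hx0 _ hr₂) _ (Metric.ball_subset_ball
        ((min_le_right _ _).trans (min_le_left _ _)) (hin σ hσ)) hξ.le hgσ.le
      rw [add_sub_cancel_left] at b1 b2
      have b3 : κ * ‖t • (τ + σ • ν)‖ ≤ κ * (t * B) := mul_le_mul_of_nonneg_left (hn σ hσ) hκ.le
      have b4 : |(dp - dm) (t • (τ + σ • ν))| ≤ 2 * (κ * (t * B)) := by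
        rw [sub_apply]
        rw [abs_le] at b1 b2 ⊢
        constructor <;> linarith [b1.1, b1.2, b2.1, b2.2]
      rw [map_smul, map_add, map_smul, smul_eq_mul, smul_eq_mul, abs_mul, abs_of_pos ht0] at b4
      have b5 : |(dp - dm) τ + σ * (dp - dm) ν| ≤ 2 * (κ * B) := by
        refine le_of_mul_le_mul_left ?_ ht0
        linarith
      have b6 : |σ * (dp - dm) ν| ≤ κ * |(dp - dm) ν| := by
        rw [abs_mul]
        exact mul_le_mul_of_nonneg_right (abs_le.2 hσ) (abs_nonneg _)
      have b7 := abs_sub ((dp - dm) τ + σ * (dp - dm) ν) (σ * (dp - dm) ν)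
      rw [add_sub_cancel_right] at b7
      linarith
    by_contra hne
    have hpos : 0 < |(dp - dm) τ| := abs_pos.2 hne
    set A := 2 * B + |(dp - dm) ν| with hA
    have hA0 : 0 ≤ A := by positivity
    -- This `κ` makes the bound `κ * A` smaller than the left-hand side.
    set κ := min (1 / 2) (|(dp - dm) τ| / (2 * (A + 1))) with hκ
    have c1 := hbound κ (lt_min (by norm_num) (by positivity))
      ((min_le_left _ _).trans_lt (by norm_num))
    have c2 : κ * A ≤ |(dp - dm) τ| / (2 * (A + 1)) * A :=
      mul_le_mul_of_nonneg_right (min_le_right _ _) hA0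
    have c3 : |(dp - dm) τ| / (2 * (A + 1)) * A < |(dp - dm) τ| := by
      rw [div_mul_eq_mul_div, div_lt_iff₀ (by positivity)]
      nlinarith
    linarith
  -- Every `v` is the sum of `g' v • ν` and a tangent vector.
  refine ⟨(dp - dm) ν, ContinuousLinearMap.ext fun v => ?_⟩
  have h := key (v - g' v • ν) (by simp [hν])
  rw [map_sub, map_smul, smul_eq_mul, sub_eq_zero] at h
  rw [h, smul_apply, smul_eq_mul, mul_comm]

/-- Changing the sign of `g` exchanges the sides, so statements about the positive side also cover
the negative one. -/
theorem IsCurveEquation.neg {Γ U : Set (ℝ × ℝ)} {g : ℝ × ℝ → ℝ} (h : IsCurveEquation Γ U g) :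
    IsCurveEquation Γ U (fun p => -g p) where
  isOpen := h.isOpen
  contDiffOn := h.contDiffOn.neg
  fderiv_ne_zero p hp := by
    rw [fderiv_fun_neg]
    exact neg_ne_zero.2 (h.fderiv_ne_zero p hp)
  mem_iff p hp := by rw [h.mem_iff p hp, neg_eq_zero]

theorem HasSideLimits.neg {E : Type*} [TopologicalSpace E] {U : Set (ℝ × ℝ)} {g : ℝ × ℝ → ℝ}
    {F : ℝ × ℝ → E} {ξ : ℝ × ℝ} {a b : E} (h : HasSideLimits U g F ξ a b) :
    HasSideLimits U (fun p => -g p) F ξ b a :=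
  ⟨by simpa [HasSideLimits] using h.2, by simpa [HasSideLimits] using h.1⟩

theorem IsCurveEquation.hasStrictFDerivAt {Γ U : Set (ℝ × ℝ)} {g : ℝ × ℝ → ℝ}
    (h : IsCurveEquation Γ U g) {p : ℝ × ℝ} (hp : p ∈ U) :
    HasStrictFDerivAt g (fderiv ℝ g p) p :=
  (h.contDiffOn.contDiffAt (h.isOpen.mem_nhds hp)).hasStrictFDerivAt one_ne_zero

/-- Otherwise `p` would be a local maximum of `g`, contrary to the nonvanishing differential. It
makes one-sided limits unique. -/
theorem IsCurveEquation.neBot_side {Γ U : Set (ℝ × ℝ)} {g : ℝ × ℝ → ℝ}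
    (h : IsCurveEquation Γ U g) {p : ℝ × ℝ} (hp : p ∈ U) (hpΓ : p ∈ Γ) :
    (𝓝[{q ∈ U | 0 < g q}] p).NeBot := by
  rw [← mem_closure_iff_nhdsWithin_neBot, mem_closure_iff_frequently]
  intro hc
  have hmax : IsLocalMax g p := by
    filter_upwards [hc, h.isOpen.mem_nhds hp] with q hq hqU
    rw [(h.mem_iff p hp).1 hpΓ]
    by_contra! hlt
    exact hq ⟨hqU, hlt⟩
  exact h.fderiv_ne_zero p hp hmax.fderiv_eq_zero

theorem eventually_side_of_tendsto {E : Type*} [SeminormedAddCommGroup E] {U : Set (ℝ × ℝ)}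
    {g : ℝ × ℝ → ℝ} {F : ℝ × ℝ → E} {ξ : ℝ × ℝ} {a : E} (hU : U ∈ 𝓝 ξ)
    (h : Tendsto F (𝓝[{p ∈ U | 0 < g p}] ξ) (𝓝 a)) {η : ℝ} (hη : 0 < η) :
    ∀ᶠ x in 𝓝 ξ, 0 < g x → ‖F x - a‖ ≤ η := by
  have h1 := h.eventually (Metric.closedBall_mem_nhds a hη)
  rw [eventually_nhdsWithin_iff] at h1
  filter_upwards [h1, hU] with x hx hxU hg
  simpa [dist_eq_norm] using hx ⟨hxU, hg⟩

/-- The definition describes `Γ` only near its own points and does not make it closed. Points of `Γ`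
still cannot accumulate at `p`: near `p` the differential of `f` is continuous, which excludes a
jump. -/
theorem IsSingularityCurve.eventually_notMem {f : ℝ × ℝ → ℝ} {Γ : Set (ℝ × ℝ)}
    (h : IsSingularityCurve f Γ) {p : ℝ × ℝ} (hp : ContDiffAt ℝ 2 f p) :
    ∀ᶠ x in 𝓝 p, x ∉ Γ := by
  filter_upwards [hp.eventually (by simp)] with x hx hxΓ
  obtain ⟨U, g, hxU, hg, -, dp, dm, hlim, hne⟩ := h x hxΓ
  have hcont : Tendsto (fderiv ℝ f) (𝓝 x) (𝓝 (fderiv ℝ f x)) :=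
    (hx.fderiv_right (m := 1) le_rfl).continuousAt
  have i1 := hg.neBot_side hxU hxΓ
  have i2 := hg.neg.neBot_side hxU hxΓ
  have e1 := tendsto_nhds_unique hlim.1 (hcont.mono_left nhdsWithin_le_nhds)
  have e2 := tendsto_nhds_unique hlim.neg.1 (hcont.mono_left nhdsWithin_le_nhds)
  exact hne (by rw [e1, e2, sub_self])

/-- Near a point of a singularity curve, `f` is to first order the sum of an affine function and
of a nonzero multiple of the positive part of a nonzero linear form. -/
theorem IsSingularityCurve.exists_kink {f : ℝ × ℝ → ℝ} {Γ : Set (ℝ × ℝ)}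
    (h : IsSingularityCurve f Γ) {ξ : ℝ × ℝ} (hξ : ξ ∈ Γ) (hf : ∀ᶠ x in 𝓝 ξ, ContinuousAt f x) :
    ∃ (n d : ℝ × ℝ →L[ℝ] ℝ) (c : ℝ), n ≠ 0 ∧ c ≠ 0 ∧ ∀ η > 0, ∃ ρ > 0,
      ∀ ζ ∈ Γ, ζ ∈ Metric.ball ξ ρ → ∀ x ∈ Metric.ball ξ ρ,
        |f x - f ζ - d (x - ζ) - c * max 0 (n (x - ζ))| ≤ η * ‖x - ζ‖ := by
  obtain ⟨U, g, hξU, hg, hf1, dp, dm, hlim, hne⟩ := h ξ hξ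
  have hUn : U ∈ 𝓝 ξ := hg.isOpen.mem_nhds hξU
  have hstrict := hg.hasStrictFDerivAt hξU
  have hn := hg.fderiv_ne_zero ξ hξU
  have hgU : ContinuousOn g U := hg.contDiffOn.continuousOn
  have hdiff : ∀ x ∈ U, g x ≠ 0 → DifferentiableAt ℝ f x := by
    intro x hx hgx
    have ho : IsOpen (U \ Γ) := by
      have e : U \ Γ = U ∩ g ⁻¹' {0}ᶜ := by
        ext q
        constructor
        · rintro ⟨hq, hqΓ⟩
          exact ⟨hq, fun h0 => hqΓ ((hg.mem_iff q hq).2 h0)⟩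
        · rintro ⟨hq, h0⟩
          exact ⟨hq, fun hqΓ => h0 ((hg.mem_iff q hq).1 hqΓ)⟩
      rw [e]
      exact hgU.isOpen_inter_preimage hg.isOpen isOpen_compl_singleton
    exact ((hf1 x ⟨hx, fun hxΓ => hgx ((hg.mem_iff x hx).1 hxΓ)⟩).contDiffAt
      (ho.mem_nhds ⟨hx, fun hxΓ => hgx ((hg.mem_iff x hx).1 hxΓ)⟩)).differentiableAt one_ne_zero
  have hp : ∀ η > 0, ∃ ρ > 0, ∀ x ∈ Metric.ball ξ ρ, ∀ y ∈ Metric.ball ξ ρ, 0 ≤ g x → 0 ≤ g y →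
      |f y - f x - dp (y - x)| ≤ η * ‖y - x‖ := fun η hη => by
    refine exists_abs_sub_sub_le_on_side hstrict hn hf (fun η hη => ?_) hη
    filter_upwards [eventually_side_of_tendsto hUn hlim.1 hη, hUn] with x hx hxU hgx
    exact ⟨hdiff x hxU hgx.ne', hx hgx⟩
  have hm : ∀ η > 0, ∃ ρ > 0, ∀ x ∈ Metric.ball ξ ρ, ∀ y ∈ Metric.ball ξ ρ, g x ≤ 0 → g y ≤ 0 →
      |f y - f x - dm (y - x)| ≤ η * ‖y - x‖ := fun η hη => by
    have := exists_abs_sub_sub_le_on_side (f := f) (D := dm) (hg.neg.hasStrictFDerivAt hξU)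
      (hg.neg.fderiv_ne_zero ξ hξU) hf (fun η hη => by
        filter_upwards [eventually_side_of_tendsto hUn hlim.neg.1 hη, hUn] with x hx hxU hgx
        exact ⟨hdiff x hxU (by intro h0; simp [h0] at hgx), hx hgx⟩) hη
    simpa only [Left.nonneg_neg_iff] using this
  obtain ⟨c, hc⟩ := exists_sub_eq_smul hstrict hn ((hg.mem_iff ξ hξU).1 hξ)
    (by filter_upwards [hg.isOpen.mem_nhds hξU] with x hx
        exact hgU.continuousAt (hg.isOpen.mem_nhds hx)) hp hm
  -- The expansion is that of the negative side, corrected on the positive side by `dp - dm = c •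
  -- n`. The same `n`, `d`, `c` serve for all `ζ` of `Γ` near `ξ`.
  refine ⟨fderiv ℝ g ξ, dm, c, hn, fun h0 => hne (by rw [hc, h0, zero_smul]), fun η hη => ?_⟩
  set n := fderiv ℝ g ξ with hndef
  set κ := η / (1 + |c|) with hκ
  have hκ0 : 0 < κ := by positivity
  have hκη : κ + |c| * κ = η := by rw [hκ]; field_simp
  obtain ⟨r₁, hr₁, h₁⟩ := hp κ hκ0
  obtain ⟨r₂, hr₂, h₂⟩ := hm κ hκ0
  obtain ⟨r₃, hr₃, h₃⟩ := Metric.eventually_nhds_iff_ball.1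
    (hstrict.isLittleO.def hκ0)
  obtain ⟨r₄, hr₄, h₄⟩ := Metric.mem_nhds_iff.1 hUn
  refine ⟨min (min r₁ r₂) (min r₃ r₄), lt_min (lt_min hr₁ hr₂) (lt_min hr₃ hr₄),
    fun ζ hζ hζb x hx => ?_⟩
  simp only [Metric.mem_ball, lt_min_iff] at hζb hx
  have hgζ : g ζ = 0 := (hg.mem_iff ζ (h₄ hζb.2.2)).1 hζ
  have s := h₃ (x, ζ) (by rw [← ball_prod_same]; exact ⟨hx.2.1, hζb.2.1⟩)
  simp only [hgζ, sub_zero, Real.norm_eq_abs] at s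
  have hcv : ∀ v, dp v = dm v + c * n v := fun v => by
    have := congrArg (fun T : ℝ × ℝ →L[ℝ] ℝ => T v) hc
    simp only [sub_apply, smul_apply, smul_eq_mul] at this
    linarith
  have finish : ∀ A B : ℝ, |A| ≤ κ * ‖x - ζ‖ → |B| ≤ κ * ‖x - ζ‖ →
      |A + c * B| ≤ η * ‖x - ζ‖ := fun A B hA hB => by
    refine (abs_add_le _ _).trans ?_
    rw [abs_mul, ← hκη]
    have := mul_le_mul_of_nonneg_left hB (abs_nonneg c)
    linarith
  -- The side of `x` is decided by `g x`, the model by `n (x - ζ)`. If their signs disagree, then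
  -- `|n (x - ζ)| ≤ κ * ‖x - ζ‖`, because `n (x - ζ)` differs from `g x` by no more than that.
  rcases le_total 0 (g x) with hgx | hgx
  · have e := h₁ ζ hζb.1.1 x hx.1.1 hgζ.ge hgx
    rw [hcv] at e
    have := finish _ (n (x - ζ) - max 0 (n (x - ζ))) e (by
      rcases le_total 0 (n (x - ζ)) with h5 | h5
      · rw [max_eq_right h5, sub_self, abs_zero]; positivity
      · rw [max_eq_left h5, sub_zero, abs_of_nonpos h5]
        linarith [(abs_le.1 s).2])
    refine le_of_eq_of_le (congrArg abs ?_) this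
    ring
  · have e := h₂ ζ hζb.1.2 x hx.1.2 hgζ.le hgx
    have := finish _ (- max 0 (n (x - ζ))) e (by
      rw [abs_neg]
      rcases le_total 0 (n (x - ζ)) with h5 | h5
      · rw [max_eq_right h5, abs_of_nonneg h5]
        linarith [(abs_le.1 s).1]
      · rw [max_eq_left h5, abs_zero]; positivity)
    refine le_of_eq_of_le (congrArg abs ?_) this
    ring

/-! ### Second derivatives up to the curve and Taylor's formula -/

theorem ContDiffAt.fderiv_fderiv_symm {f : ℝ × ℝ → ℝ} {p : ℝ × ℝ} (hp : ContDiffAt ℝ 2 f p)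
    (u v : ℝ × ℝ) : fderiv ℝ (fderiv ℝ f) p u v = fderiv ℝ (fderiv ℝ f) p v u :=
  (hp.isSymmSndFDerivAt (by simp)).eq u v

theorem symm_of_tendsto {l : Filter (ℝ × ℝ)} [l.NeBot] {D : ℝ × ℝ → ℝ × ℝ →L[ℝ] ℝ × ℝ →L[ℝ] ℝ}
    {H : ℝ × ℝ →L[ℝ] ℝ × ℝ →L[ℝ] ℝ} (h : Tendsto D l (𝓝 H))
    (hs : ∀ᶠ x in l, ∀ u v, D x u v = D x v u) (u v : ℝ × ℝ) : H u v = H v u := by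
  have ev : ∀ u v, Tendsto (fun x => D x u v) l (𝓝 (H u v)) := fun u v =>
    (((ContinuousLinearMap.apply ℝ ℝ v).continuous.comp
      (ContinuousLinearMap.apply ℝ (ℝ × ℝ →L[ℝ] ℝ) u).continuous).tendsto H).comp h
  exact tendsto_nhds_unique_of_eventuallyEq (ev u v) (ev v u) (hs.mono fun x hx => hx u v)

/-- Near each point of `Ω`, the second derivative of `f` is almost constant on connected sets which
do not meet `Γ`. -/
theorem exists_second_derivative_limits {f : ℝ × ℝ → ℝ} {Ω Γ : Set (ℝ × ℝ)} (hΩ : IsOpen Ω)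
    (hreg : IsRegularOff f Ω Γ) {p : ℝ × ℝ} (hp : p ∈ Ω) :
    ∃ H₁ H₂ : ℝ × ℝ →L[ℝ] ℝ × ℝ →L[ℝ] ℝ, (∀ u v, H₁ u v = H₁ v u) ∧ (∀ u v, H₂ u v = H₂ v u) ∧
      ∀ η > 0, ∃ ρ > 0, ∀ S : Set (ℝ × ℝ), IsPreconnected S → S ⊆ Metric.ball p ρ → Γ ∩ S = ∅ →
        (∀ x ∈ S, ContDiffAt ℝ 2 f x) ∧
          ((∀ x ∈ S, ‖fderiv ℝ (fderiv ℝ f) x - H₁‖ ≤ η) ∨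
            ∀ x ∈ S, ‖fderiv ℝ (fderiv ℝ f) x - H₂‖ ≤ η) := by
  obtain ⟨r₀, hr₀, h₀⟩ := Metric.mem_nhds_iff.1 (hΩ.mem_nhds hp)
  have hC2 : ∀ S : Set (ℝ × ℝ), S ⊆ Metric.ball p r₀ → Γ ∩ S = ∅ →
      ∀ x ∈ S, ContDiffAt ℝ 2 f x := fun S hS hΓ x hx =>
    hreg.1 x ⟨h₀ (hS hx), fun hxΓ => (hΓ ▸ ⟨hxΓ, hx⟩ : x ∈ (∅ : Set (ℝ × ℝ)))⟩
  by_cases hpΓ : p ∈ Γ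
  · obtain ⟨U, g, hpU, hg, hp1, hm1, hlim⟩ := hreg.2 p hpΓ
    have hUn : U ∈ 𝓝 p := hg.isOpen.mem_nhds hpU
    have i1 := hg.neBot_side hpU hpΓ
    have i2 := hg.neg.neBot_side hpU hpΓ
    have hsymm : ∀ g : ℝ × ℝ → ℝ, IsCurveEquation Γ U g →
        ∀ᶠ x in 𝓝[{q ∈ U | 0 < g q}] p, ∀ u v,
          fderiv ℝ (fderiv ℝ f) x u v = fderiv ℝ (fderiv ℝ f) x v u := by
      intro g hg
      filter_upwards [self_mem_nhdsWithin, nhdsWithin_le_nhds (hΩ.mem_nhds hp)] with x hx hxΩ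
      exact (hreg.1 x ⟨hxΩ, fun hxΓ => hx.2.ne' ((hg.mem_iff x hx.1).1 hxΓ)⟩).fderiv_fderiv_symm
    refine ⟨hp1, hm1, symm_of_tendsto hlim.1 (hsymm g hg),
      symm_of_tendsto hlim.neg.1 (hsymm _ hg.neg), fun η hη => ?_⟩
    obtain ⟨r₁, hr₁, h₁⟩ := Metric.eventually_nhds_iff_ball.1
      ((eventually_side_of_tendsto (F := fderiv ℝ (fderiv ℝ f)) (a := hp1) hUn hlim.1 hη).and
        ((eventually_side_of_tendsto (F := fderiv ℝ (fderiv ℝ f)) (a := hm1) hUn hlim.neg.1 hη).and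
          hUn))
    refine ⟨min r₀ r₁, lt_min hr₀ hr₁, fun S hS hSb hSΓ =>
      ⟨hC2 S (hSb.trans (Metric.ball_subset_ball (min_le_left _ _))) hSΓ, ?_⟩⟩
    have hS1 : S ⊆ Metric.ball p r₁ := hSb.trans (Metric.ball_subset_ball (min_le_right _ _))
    have hne : ∀ x ∈ S, g x ≠ 0 := fun x hx h0 =>
      (hSΓ ▸ ⟨(hg.mem_iff x (h₁ x (hS1 hx)).2.2).2 h0, hx⟩ : x ∈ (∅ : Set (ℝ × ℝ)))
    have hgc : ContinuousOn g S := fun x hx =>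
      (hg.contDiffOn.continuousOn x (h₁ x (hS1 hx)).2.2).mono fun y hy => (h₁ y (hS1 hy)).2.2
    have himg := (hS.image g hgc).ordConnected
    -- On the connected set `S` the continuous function `g` has no zero, so `S` lies on one side of
    -- the curve.
    by_cases hpos : ∃ x ∈ S, 0 < g x
    · obtain ⟨x, hx, hgx⟩ := hpos
      refine Or.inl fun y hy => (h₁ y (hS1 hy)).1 ?_
      by_contra! hgy
      obtain ⟨z, hz, hgz⟩ := himg.out (mem_image_of_mem g hy) (mem_image_of_mem g hx) ⟨hgy, hgx.le⟩
      exact hne z hz hgz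
    · push Not at hpos
      refine Or.inr fun y hy => (h₁ y (hS1 hy)).2.1 ?_
      have := lt_of_le_of_ne (hpos y hy) (hne y hy)
      linarith
  · have hcd := hreg.1 p ⟨hp, hpΓ⟩
    refine ⟨fderiv ℝ (fderiv ℝ f) p, fderiv ℝ (fderiv ℝ f) p, hcd.fderiv_fderiv_symm,
      hcd.fderiv_fderiv_symm, fun η hη => ?_⟩
    have hcont : ContinuousAt (fderiv ℝ (fderiv ℝ f)) p :=
      ((hcd.fderiv_right (m := 1) le_rfl).fderiv_right (m := 0) (by norm_num)).continuousAt
    obtain ⟨r₁, hr₁, h₁⟩ := Metric.mem_nhds_iff.1 (hcont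
      (Metric.closedBall_mem_nhds (fderiv ℝ (fderiv ℝ f) p) hη))
    refine ⟨min r₀ r₁, lt_min hr₀ hr₁, fun S _ hSb hSΓ =>
      ⟨hC2 S (hSb.trans (Metric.ball_subset_ball (min_le_left _ _))) hSΓ, Or.inl fun x hx => ?_⟩⟩
    exact (dist_eq_norm (fderiv ℝ (fderiv ℝ f) x) (fderiv ℝ (fderiv ℝ f) p)).symm.le.trans
      (h₁ (Metric.ball_subset_ball (min_le_right _ _) (hSb hx)))

/-- Taylor's formula of order two with a remainder controlled by the oscillation of the second
derivative. -/
theorem abs_sub_taylor_le {f : ℝ × ℝ → ℝ} {S : Set (ℝ × ℝ)} (hS : Convex ℝ S)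
    {H : ℝ × ℝ →L[ℝ] ℝ × ℝ →L[ℝ] ℝ} (hH : ∀ u v, H u v = H v u) {η : ℝ}
    (hf : ∀ x ∈ S, ContDiffAt ℝ 2 f x) (hη : ∀ x ∈ S, ‖fderiv ℝ (fderiv ℝ f) x - H‖ ≤ η)
    {p x : ℝ × ℝ} (hp : p ∈ S) (hx : x ∈ S) :
    |f x - (f p + fderiv ℝ f p (x - p) + 1 / 2 * H (x - p) (x - p))| ≤ η * ‖x - p‖ ^ 2 := by
  have h1 : ∀ z ∈ S, ‖fderiv ℝ f z - fderiv ℝ f p - H (z - p)‖ ≤ η * ‖z - p‖ := fun z hz =>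
    hS.norm_image_sub_le_of_norm_hasFDerivWithin_le' (f' := fderiv ℝ (fderiv ℝ f))
      (fun y hy => (((hf y hy).fderiv_right (m := 1) le_rfl).differentiableAt
        one_ne_zero).hasFDerivAt.hasFDerivWithinAt) hη hp hz
  have hη0 : 0 ≤ η := (norm_nonneg (fderiv ℝ (fderiv ℝ f) p - H)).trans (hη p hp)
  -- On this convex piece the first-order bound `η * ‖z - p‖` is at most `η * ‖x - p‖`, so a second
  -- use of the mean value inequality gives the square.
  set T := S ∩ Metric.closedBall p ‖x - p‖ with hT
  have hTc : Convex ℝ T := hS.inter (convex_closedBall _ _)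
  have hG : ∀ z ∈ T, HasFDerivWithinAt
      (fun z => f z - 1 / 2 * H (z - p) (z - p)) (fderiv ℝ f z - H (z - p)) T z := by
    intro z hz
    have d1 : HasFDerivAt (fun z : ℝ × ℝ => z - p) (ContinuousLinearMap.id ℝ (ℝ × ℝ)) z :=
      (hasFDerivAt_id z).sub_const p
    have d2 : HasFDerivAt (fun z : ℝ × ℝ => H (z - p)) H z :=
      (H.hasFDerivAt.comp z d1).congr_fderiv (ContinuousLinearMap.comp_id H)
    have d3 := (d2.clm_apply d1).const_mul (1 / 2 : ℝ)
    refine (HasFDerivAt.congr_fderiv (((hf z hz.1).differentiableAt two_ne_zero).hasFDerivAt.sub d3)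
      (ContinuousLinearMap.ext fun v => ?_)).hasFDerivWithinAt
    have := hH v (z - p)
    simp only [sub_apply, smul_apply, add_apply, ContinuousLinearMap.comp_apply,
      ContinuousLinearMap.flip_apply, ContinuousLinearMap.id_apply, smul_eq_mul, this]
    ring
  have h2 := hTc.norm_image_sub_le_of_norm_hasFDerivWithin_le' (φ := fderiv ℝ f p) (x := p) (y := x)
    (C := η * ‖x - p‖) hG (fun z hz => by
      rw [sub_right_comm]
      refine (h1 z hz.1).trans (mul_le_mul_of_nonneg_left ?_ hη0)
      simpa [dist_eq_norm] using hz.2) ⟨hp, by simp⟩ ⟨hx, by simp [dist_eq_norm]⟩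
  rw [Real.norm_eq_abs] at h2
  simp only [sub_self, map_zero, mul_zero, sub_zero] at h2
  calc _ = |f x - 1 / 2 * H (x - p) (x - p) - f p - fderiv ℝ f p (x - p)| := by congr 1; ring
    _ ≤ _ := h2
    _ = _ := by ring

/-! ### Stencil boxes and localization -/

/-- The point of the stencil with the indices `a`, `b`. -/
def gridPoint (h : ℝ) (r : ℕ) (j i : ℤ) (k w a b : ℕ) : ℝ × ℝ :=
  (stencilNode h r j k a, stencilNode h r i w b)

theorem gridPoint_eq (h : ℝ) (r : ℕ) (j i : ℤ) (k w a b : ℕ) :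
    gridPoint h r j i k w a b = gridPoint h r j i k w 0 0 + h • ((a : ℝ), (b : ℝ)) := by
  ext <;> simp [gridPoint, stencilNode] <;> ring

theorem mem_stencilBox_iff {h : ℝ} {r : ℕ} {j i : ℤ} {k w : ℕ} {x : ℝ × ℝ} :
    x ∈ stencilBox r h j i k w ↔
      ((gridPoint h r j i k w 0 0).1 ≤ x.1 ∧ x.1 ≤ (gridPoint h r j i k w 0 0).1 + r * h) ∧
      ((gridPoint h r j i k w 0 0).2 ≤ x.2 ∧ x.2 ≤ (gridPoint h r j i k w 0 0).2 + r * h) := by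
  have e1 : ∀ (j : ℤ) (k : ℕ), ((j - (r : ℤ) + (k : ℤ) : ℤ) : ℝ) * h = stencilNode h r j k 0 := by
    intro j k; simp only [stencilNode]; push_cast; ring
  have e2 : ∀ (j : ℤ) (k : ℕ), ((j + (k : ℤ) : ℤ) : ℝ) * h = stencilNode h r j k 0 + r * h := by
    intro j k; simp only [stencilNode]; push_cast; ring
  simp only [stencilBox, mem_prod, mem_Icc, gridPoint, e1, e2]

theorem gridPoint_mem_stencilBox {h : ℝ} (hh : 0 < h) {r : ℕ} (j i : ℤ) (k w : ℕ) {a b : ℕ}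
    (ha : a ≤ r) (hb : b ≤ r) : gridPoint h r j i k w a b ∈ stencilBox r h j i k w := by
  rw [mem_stencilBox_iff, gridPoint_eq h r j i k w a b]
  have ha' : (a : ℝ) * h ≤ r * h := mul_le_mul_of_nonneg_right (by exact_mod_cast ha) hh.le
  have hb' : (b : ℝ) * h ≤ r * h := mul_le_mul_of_nonneg_right (by exact_mod_cast hb) hh.le
  have ha0 : 0 ≤ (a : ℝ) * h := by positivity
  have hb0 : 0 ≤ (b : ℝ) * h := by positivity
  simp only [Prod.fst_add, Prod.snd_add, Prod.smul_fst, Prod.smul_snd, smul_eq_mul]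
  refine ⟨⟨?_, ?_⟩, ?_, ?_⟩ <;> linarith

theorem norm_sub_le_of_mem_stencilBox {h : ℝ} {r : ℕ} {j i : ℤ} {k w : ℕ} {x y : ℝ × ℝ}
    (hx : x ∈ stencilBox r h j i k w) (hy : y ∈ stencilBox r h j i k w) : ‖x - y‖ ≤ r * h := by
  rw [mem_stencilBox_iff] at hx hy
  refine max_le (abs_le.2 ⟨?_, ?_⟩) (abs_le.2 ⟨?_, ?_⟩) <;>
    simp only [Prod.fst_sub, Prod.snd_sub] <;> linarith [hx.1.1, hx.1.2, hx.2.1, hx.2.2, hy.1.1,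
      hy.1.2, hy.2.1, hy.2.2]

theorem convex_stencilBox (h : ℝ) (r : ℕ) (j i : ℤ) (k w : ℕ) :
    Convex ℝ (stencilBox r h j i k w) :=
  (convex_Icc _ _).prod (convex_Icc _ _)

/-- An estimate for small stencil boxes in a compact set may be checked locally. -/
theorem exists_uniform_of_local {K : Set (ℝ × ℝ)} (hK : IsCompact K) (r : ℕ)
    (P : ℝ → ℝ → ℤ → ℤ → ℕ → ℕ → Prop)
    (hP : ∀ c c' h j i k w, 0 < c → c ≤ c' → P c' h j i k w → P c h j i k w)
    (hloc : ∀ p ∈ K, ∃ c > 0, ∃ ρ > 0, ∀ h, 0 < h → ∀ j i k w, k < r → w < r →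
      stencilBox r h j i k w ⊆ Metric.ball p ρ → stencilBox r h j i k w ⊆ K → P c h j i k w) :
    ∃ c > 0, ∀ h, 0 < h → h < c → ∀ j i k w, k < r → w < r →
      stencilBox r h j i k w ⊆ K → P c h j i k w := by
  have key : ∃ c > 0, ∀ h, 0 < h → h < c → ∀ j i k w, k < r → w < r →
      gridPoint h r j i k w 0 0 ∈ K → stencilBox r h j i k w ⊆ K → P c h j i k w := by
    -- A single number `c` bounds both the mesh size and the estimate, and the latter is monotone in
    -- `c`, so finitely many local constants are merged by taking their minimum. The corner of the
    -- box decides which local estimate applies.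
    refine hK.induction_on (p := fun A => ∃ c > 0, ∀ h, 0 < h → h < c → ∀ j i k w, k < r → w < r →
      gridPoint h r j i k w 0 0 ∈ A → stencilBox r h j i k w ⊆ K → P c h j i k w) ?_ ?_ ?_ ?_
    · exact ⟨1, one_pos, fun _ _ _ _ _ _ _ _ _ hm => absurd hm (notMem_empty _)⟩
    · rintro A B hAB ⟨c, hc, h1⟩
      exact ⟨c, hc, fun h h0 hhc j i k w hk hw hm => h1 h h0 hhc j i k w hk hw (hAB hm)⟩
    · rintro A B ⟨c, hc, h1⟩ ⟨c', hc', h2⟩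
      have hmin := lt_min hc hc'
      refine ⟨min c c', hmin, fun h h0 hhc j i k w hk hw hm hb => ?_⟩
      rcases hm with hm | hm
      · exact hP _ _ _ _ _ _ _ hmin (min_le_left _ _)
          (h1 h h0 (hhc.trans_le (min_le_left _ _)) j i k w hk hw hm hb)
      · exact hP _ _ _ _ _ _ _ hmin (min_le_right _ _)
          (h2 h h0 (hhc.trans_le (min_le_right _ _)) j i k w hk hw hm hb)
    · intro p hp
      obtain ⟨c, hc, ρ, hρ, h1⟩ := hloc p hp
      -- With the corner within `ρ / 2` of `p`, the box of side `r * h` stays in the ball of radius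
      -- `ρ`.
      have hmin : 0 < min c (ρ / (2 * (r + 1))) := lt_min hc (by positivity)
      refine ⟨Metric.ball p (ρ / 2), mem_nhdsWithin_of_mem_nhds (Metric.ball_mem_nhds _ (half_pos hρ)),
        _, hmin, fun h h0 hhc j i k w hk hw hm hb => hP _ _ _ _ _ _ _ hmin (min_le_left _ _)
          (h1 h h0 j i k w hk hw (fun x hx => ?_) hb)⟩
      have h2 := norm_sub_le_of_mem_stencilBox hx
        (gridPoint_mem_stencilBox h0 j i k w (Nat.zero_le r) (Nat.zero_le r))
      have h3 : h * (2 * (r + 1)) < ρ :=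
        (lt_div_iff₀ (by positivity)).1 (hhc.trans_le (min_le_right _ _))
      rw [← dist_eq_norm] at h2
      rw [Metric.mem_ball] at hm ⊢
      have := dist_triangle x (gridPoint h r j i k w 0 0) p
      nlinarith
  obtain ⟨c, hc, h1⟩ := key
  exact ⟨c, hc, fun h h0 hhc j i k w hk hw hb => h1 h h0 hhc j i k w hk hw
    (hb (gridPoint_mem_stencilBox h0 j i k w (Nat.zero_le r) (Nat.zero_le r))) hb⟩

/-! ### Model data: quadratic forms and kinks -/

theorem apply_gridVector (T : ℝ × ℝ →L[ℝ] ℝ) (a b : ℝ) :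
    T (a, b) = T (1, 0) * a + T (0, 1) * b := by
  have : ((a, b) : ℝ × ℝ) = a • ((1 : ℝ), (0 : ℝ)) + b • ((0 : ℝ), (1 : ℝ)) := by
    ext <;> simp
  rw [this, map_add, map_smul, map_smul, smul_eq_mul, smul_eq_mul, mul_comm, mul_comm b]

/-- The nodal values of the quadratic form associated with a bilinear form. -/
noncomputable def quadData (H : ℝ × ℝ →L[ℝ] ℝ × ℝ →L[ℝ] ℝ) (a b : ℕ) : ℝ :=
  1 / 2 * H ((a : ℝ), (b : ℝ)) ((a : ℝ), (b : ℝ))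

/-- The nodal values of the positive part of a linear form which is centred at `z`. -/
noncomputable def kinkData (n : ℝ × ℝ →L[ℝ] ℝ) (z : ℝ × ℝ) (a b : ℕ) : ℝ :=
  max 0 (n (((a : ℝ), (b : ℝ)) - z))

/-- Taylor's formula at the corner of the box; the affine part is invisible to the form. -/
theorem gridForm_eq_quadData_add {f : ℝ × ℝ → ℝ} {r : ℕ} (hr : 2 ≤ r) {h : ℝ} (hh : 0 < h)
    {j i : ℤ} {k w : ℕ} {H : ℝ × ℝ →L[ℝ] ℝ × ℝ →L[ℝ] ℝ} (hH : ∀ u v, H u v = H v u) {η : ℝ}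
    (hf : ∀ x ∈ stencilBox r h j i k w, ContDiffAt ℝ 2 f x)
    (hη : ∀ x ∈ stencilBox r h j i k w, ‖fderiv ℝ (fderiv ℝ f) x - H‖ ≤ η) :
    ∃ E : ℕ → ℕ → ℝ, (∀ a ≤ r, ∀ b ≤ r, |E a b| ≤ η * (r * h) ^ 2) ∧
      gridForm r k w (fun a b => f (gridPoint h r j i k w a b)) =
        gridForm r k w (fun a b => h ^ 2 * quadData H a b + E a b) := by
  set q := gridPoint h r j i k w 0 0 with hq
  have hqm : q ∈ stencilBox r h j i k w := gridPoint_mem_stencilBox hh _ _ _ _ r.zero_le r.zero_le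
  have hη0 : 0 ≤ η := (norm_nonneg (fderiv ℝ (fderiv ℝ f) q - H)).trans (hη q hqm)
  refine ⟨fun a b => f (gridPoint h r j i k w a b) -
    (f q + fderiv ℝ f q (gridPoint h r j i k w a b - q) + 1 / 2 *
      H (gridPoint h r j i k w a b - q) (gridPoint h r j i k w a b - q)), fun a ha b hb => ?_, ?_⟩
  · have hm := gridPoint_mem_stencilBox hh j i k w ha hb
    refine (abs_sub_taylor_le (convex_stencilBox h r j i k w) hH hf hη hqm hm).trans
      (mul_le_mul_of_nonneg_left ?_ hη0)
    exact pow_le_pow_left₀ (norm_nonneg _) (norm_sub_le_of_mem_stencilBox hm hqm) 2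
  · rw [← gridForm_affine_add r k w (by omega) (f q) (h * fderiv ℝ f q (1, 0))
      (h * fderiv ℝ f q (0, 1)) (fun a b => h ^ 2 * quadData H a b + _)]
    refine gridForm_congr fun a _ b _ => ?_
    rw [gridPoint_eq, ← hq, add_sub_cancel_left, map_smul (fderiv ℝ f q), map_smul H, smul_apply,
      map_smul (H ((a : ℝ), (b : ℝ))),
      apply_gridVector (fderiv ℝ f q) a b]
    simp only [quadData, smul_eq_mul]
    ring

/-- The positive part is homogeneous of degree one, so rescaling extracts a factor `h` and centres
the kink at the position of `ζ` in grid units. -/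
theorem gridForm_eq_kinkData_add {f : ℝ × ℝ → ℝ} {r : ℕ} (hr : 2 ≤ r) {h : ℝ} (hh : 0 < h)
    {j i : ℤ} {k w : ℕ} {n d : ℝ × ℝ →L[ℝ] ℝ} {c η : ℝ} (hη0 : 0 ≤ η) {ζ : ℝ × ℝ}
    (hζ : ζ ∈ stencilBox r h j i k w)
    (hη : ∀ x ∈ stencilBox r h j i k w,
      |f x - f ζ - d (x - ζ) - c * max 0 (n (x - ζ))| ≤ η * ‖x - ζ‖) :
    ∃ E : ℕ → ℕ → ℝ, (∀ a ≤ r, ∀ b ≤ r, |E a b| ≤ η * (r * h)) ∧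
      gridForm r k w (fun a b => f (gridPoint h r j i k w a b)) =
        gridForm r k w (fun a b =>
          (c * h) * kinkData n (h⁻¹ • (ζ - gridPoint h r j i k w 0 0)) a b + E a b) := by
  set q := gridPoint h r j i k w 0 0 with hq
  set z := h⁻¹ • (ζ - q) with hz
  have hx : ∀ a b, gridPoint h r j i k w a b - ζ = h • (((a : ℝ), (b : ℝ)) - z) := by
    intro a b
    rw [gridPoint_eq, ← hq, smul_sub, hz, smul_inv_smul₀ hh.ne']
    abel
  refine ⟨fun a b => f (gridPoint h r j i k w a b) - f ζ - d (gridPoint h r j i k w a b - ζ) -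
    c * max 0 (n (gridPoint h r j i k w a b - ζ)), fun a ha b hb => ?_, ?_⟩
  · have hm := gridPoint_mem_stencilBox hh j i k w ha hb
    exact (hη _ hm).trans
      (mul_le_mul_of_nonneg_left (norm_sub_le_of_mem_stencilBox hm hζ) hη0)
  · rw [← gridForm_affine_add r k w (by omega) (f ζ - h * d z) (h * d (1, 0))
      (h * d (0, 1)) (fun a b => c * h * kinkData n z a b + _)]
    refine gridForm_congr fun a _ b _ => ?_
    have e : max 0 (h * n (((a : ℝ), (b : ℝ)) - z)) = h * max 0 (n (((a : ℝ), (b : ℝ)) - z)) := by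
      rw [mul_max_of_nonneg _ _ hh.le, mul_zero]
    rw [hx, map_smul d h, map_smul n h, smul_eq_mul, smul_eq_mul, e, map_sub d, apply_gridVector d a b]
    simp only [kinkData]
    ring

/-- Second differences in each direction and the mixed difference recover all coefficients of `H`;
the node with index `2` exists since `r ≥ 2`. -/
theorem not_affine_quadData {r : ℕ} (hr : 2 ≤ r) {H : ℝ × ℝ →L[ℝ] ℝ × ℝ →L[ℝ] ℝ}
    (hH : ∀ u v, H u v = H v u) (hne : H ≠ 0) :
    ¬ ∃ c₀ c₁ c₂ : ℝ, ∀ a ≤ r, ∀ b ≤ r, quadData H a b = c₀ + c₁ * a + c₂ * b := by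
  rintro ⟨c₀, c₁, c₂, hc⟩
  set A := H (1, 0) (1, 0)
  set B := H (1, 0) (0, 1)
  set D := H (0, 1) (0, 1)
  have hHv : ∀ a b a' b' : ℝ, H (a, b) (a', b') = A * a * a' + B * (a * b' + b * a') + D * b * b' := by
    intro a b a' b'
    have e1 : H (0, 1) (1, 0) = B := hH _ _
    have e2 := apply_gridVector (H.flip (a', b')) a b
    simp only [ContinuousLinearMap.flip_apply] at e2
    rw [e2, apply_gridVector (H (1, 0)), apply_gridVector (H (0, 1)), e1]
    ring
  have e00 := hc 0 (by omega) 0 (by omega)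
  have e10 := hc 1 (by omega) 0 (by omega)
  have e20 := hc 2 hr 0 (by omega)
  have e01 := hc 0 (by omega) 1 (by omega)
  have e02 := hc 0 (by omega) 2 hr
  have e11 := hc 1 (by omega) 1 (by omega)
  simp only [quadData, hHv] at e00 e10 e20 e01 e02 e11
  push_cast at e00 e10 e20 e01 e02 e11
  have hA : A = 0 := by linarith
  have hD : D = 0 := by linarith
  have hB : B = 0 := by linarith
  refine hne (ContinuousLinearMap.ext fun u => ContinuousLinearMap.ext fun v => ?_)
  obtain ⟨u1, u2⟩ := u
  obtain ⟨v1, v2⟩ := v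
  rw [hHv, hA, hB, hD]
  simp

/-- The positive part of an affine function which changes sign strictly between `0` and `r` is not
collinear at `0`, `1`, `r`, because `1` is strictly between the ends. -/
theorem not_opposite_signs_of_max_affine {x y c₀ c₁ r : ℝ} (hr : 2 ≤ r)
    (h0 : max 0 x = c₀) (h1 : max 0 (x + y) = c₀ + c₁) (h2 : max 0 (x + r * y) = c₀ + c₁ * r) :
    (x < 0 → x + r * y ≤ 0) ∧ (0 < x → 0 ≤ x + r * y) := by
  constructor
  · intro hx
    by_contra! hy
    rw [max_eq_left hx.le] at h0
    rw [max_eq_right hy.le] at h2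
    rcases max_cases 0 (x + y) with ⟨e, h⟩ | ⟨e, h⟩ <;> rw [e] at h1 <;> nlinarith
  · intro hx
    by_contra! hy
    rw [max_eq_right hx.le] at h0
    rw [max_eq_left hy.le] at h2
    rcases max_cases 0 (x + y) with ⟨e, h⟩ | ⟨e, h⟩ <;> rw [e] at h1 <;> nlinarith

/-- The linear form centred at the interior point `z` has strictly opposite signs at two opposite
corners of the square. If the data were affine, no edge could carry a strict sign change, so the
form would vanish at the other two corners. The sums of the data over the two diagonals agree for
affine data, but here one is zero and the other positive. -/
theorem not_affine_kinkData {r : ℕ} (hr : 2 ≤ r) {n : ℝ × ℝ →L[ℝ] ℝ} (hn : n ≠ 0) {z : ℝ × ℝ}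
    (hz1 : 0 < z.1 ∧ z.1 < r) (hz2 : 0 < z.2 ∧ z.2 < r) :
    ¬ ∃ c₀ c₁ c₂ : ℝ, ∀ a ≤ r, ∀ b ≤ r, kinkData n z a b = c₀ + c₁ * a + c₂ * b := by
  rintro ⟨c₀, c₁, c₂, hc⟩
  have hr' : (2 : ℝ) ≤ r := by exact_mod_cast hr
  set α := n (1, 0) with hα
  set β := n (0, 1) with hβ
  have hk : ∀ a b : ℕ, kinkData n z a b = max 0 (α * (a - z.1) + β * (b - z.2)) := fun a b => by
    rw [kinkData, ← apply_gridVector n]; rfl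
  simp only [hk] at hc
  have row : ∀ b ≤ r, _ := fun b hb => not_opposite_signs_of_max_affine (x := α * (0 - z.1) + β * (b - z.2))
    (y := α) (c₀ := c₀ + c₂ * b) (c₁ := c₁) hr'
    (by have := hc 0 (by omega) b hb; push_cast at this; rw [this]; ring)
    (by have := hc 1 (by omega) b hb
        rw [show α * (0 - z.1) + β * (b - z.2) + α = α * ((1 : ℕ) - z.1) + β * (b - z.2) by
          push_cast; ring, this]
        push_cast; ring)
    (by have := hc r le_rfl b hb
        rw [show α * (0 - z.1) + β * (b - z.2) + r * α = α * (r - z.1) + β * (b - z.2) by ring,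
          this]
        ring)
  have col : ∀ a ≤ r, _ := fun a ha => not_opposite_signs_of_max_affine (x := α * (a - z.1) + β * (0 - z.2))
    (y := β) (c₀ := c₀ + c₁ * a) (c₁ := c₂) hr'
    (by have := hc a ha 0 (by omega); push_cast at this; rw [this]; ring)
    (by have := hc a ha 1 (by omega)
        rw [show α * (a - z.1) + β * (0 - z.2) + β = α * (a - z.1) + β * ((1 : ℕ) - z.2) by
          push_cast; ring, this]
        push_cast; ring)
    (by have := hc a ha r le_rfl
        rw [show α * (a - z.1) + β * (0 - z.2) + r * β = α * (a - z.1) + β * (r - z.2) by ring,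
          this])
  have r0 := row 0 (by omega)
  have rr := row r le_rfl
  have k0 := col 0 (by omega)
  have kr := col r le_rfl
  have d00 := hc 0 (by omega) 0 (by omega)
  have dr0 := hc r le_rfl 0 (by omega)
  have d0r := hc 0 (by omega) r le_rfl
  have drr := hc r le_rfl r le_rfl
  push_cast at r0 rr k0 kr d00 dr0 d0r drr
  set A := α * (0 - z.1) + β * (0 - z.2) with hA
  set B := α * (r - z.1) + β * (0 - z.2) with hB
  set C := α * (0 - z.1) + β * (r - z.2) with hC
  set D := α * (r - z.1) + β * (r - z.2) with hD
  rw [show A + r * α = B by rw [hA, hB]; ring] at r0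
  rw [show C + r * α = D by rw [hC, hD]; ring] at rr
  rw [show A + r * β = C by rw [hA, hC]; ring] at k0
  rw [show B + r * β = D by rw [hB, hD]; ring] at kr
  have hαβ : α ≠ 0 ∨ β ≠ 0 := by
    by_contra! h0
    refine hn (ContinuousLinearMap.ext fun v => ?_)
    obtain ⟨v1, v2⟩ := v
    rw [apply_gridVector, ← hα, ← hβ, h0.1, h0.2]
    simp
  have hsum : max 0 A + max 0 D = max 0 B + max 0 C := by rw [d00, dr0, d0r, drr]; ring
  have clash : ∀ {A B C D : ℝ}, A < 0 → 0 < D → B = 0 → C = 0 →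
      max 0 A + max 0 D = max 0 B + max 0 C → False := by
    intro A B C D h1 h2 h3 h4 h5
    rw [max_eq_left h1.le, max_eq_right h2.le, h3, h4] at h5
    simp at h5
    linarith
  have pos : ∀ {x y s t : ℝ}, 0 ≤ x → 0 ≤ y → x ≠ 0 ∨ y ≠ 0 → 0 < s → 0 < t → 0 < x * s + y * t := by
    intro x y s t hx hy hxy hs ht
    rcases hxy with h | h
    · have := mul_pos (lt_of_le_of_ne hx h.symm) hs
      have := mul_nonneg hy ht.le
      linarith
    · have := mul_pos (lt_of_le_of_ne hy h.symm) ht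
      have := mul_nonneg hx hs.le
      linarith
  have z1 := hz1.1
  have z1' : 0 < r - z.1 := sub_pos.2 hz1.2
  have z2 := hz2.1
  have z2' : 0 < r - z.2 := sub_pos.2 hz2.2
  have flip : ∀ {x y : ℝ}, (x < 0 → y ≤ 0) ∧ (0 < x → 0 ≤ y) →
      (y < 0 → x ≤ 0) ∧ (0 < y → 0 ≤ x) := fun h =>
    ⟨fun hy => not_lt.1 fun hx => (h.2 hx).not_gt hy, fun hy => not_lt.1 fun hx => (h.1 hx).not_gt hy⟩
  have neg_iff : α ≠ 0 ∨ β ≠ 0 → (-α ≠ 0 ∨ -β ≠ 0) ∧ (-α ≠ 0 ∨ β ≠ 0) ∧ (α ≠ 0 ∨ -β ≠ 0) := by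
    simp
  obtain ⟨n1, n2, n3⟩ := neg_iff hαβ
  rcases le_total 0 α with ha | ha <;> rcases le_total 0 β with hb | hb
  · have p1 := pos ha hb hαβ z1 z2
    have p2 := pos ha hb hαβ z1' z2'
    have hA0 : A < 0 := by rw [hA]; linarith
    exact clash hA0 p2 (le_antisymm (r0.1 hA0) ((flip kr).2 p2))
      (le_antisymm (k0.1 hA0) ((flip rr).2 p2)) hsum
  · have p1 := pos ha (neg_nonneg.2 hb) n3 z1 z2'
    have p2 := pos ha (neg_nonneg.2 hb) n3 z1' z2
    have hC0 : C < 0 := by rw [hC]; linarith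
    have hB0 : 0 < B := by rw [hB]; linarith
    exact clash hC0 hB0 (le_antisymm ((flip k0).1 hC0) ((flip r0).2 hB0))
      (le_antisymm (rr.1 hC0) (kr.2 hB0)) (by linarith)
  · have p1 := pos (neg_nonneg.2 ha) hb n2 z1 z2'
    have p2 := pos (neg_nonneg.2 ha) hb n2 z1' z2
    have hC0 : 0 < C := by rw [hC]; linarith
    have hB0 : B < 0 := by rw [hB]; linarith
    exact clash hB0 hC0 (le_antisymm ((flip r0).1 hB0) ((flip k0).2 hC0))
      (le_antisymm (kr.1 hB0) (rr.2 hC0)) (by linarith)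
  · have p1 := pos (neg_nonneg.2 ha) (neg_nonneg.2 hb) n1 z1 z2
    have p2 := pos (neg_nonneg.2 ha) (neg_nonneg.2 hb) n1 z1' z2'
    have hA0 : 0 < A := by rw [hA]; linarith
    have hD0 : D < 0 := by rw [hD]; linarith
    exact clash hD0 hA0 (le_antisymm ((flip kr).1 hD0) (r0.2 hA0))
      (le_antisymm ((flip rr).1 hD0) (k0.2 hA0)) (by linarith)

/-! ### The upper and lower estimates -/

theorem squareBeta_eq_gridForm_gridPoint (f : ℝ × ℝ → ℝ) (r : ℕ) {h : ℝ} (hh : 0 < h) (j i : ℤ)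
    (k w : ℕ) : squareBeta f r h j i k w =
      (h ^ 2)⁻¹ * gridForm r k w (fun a b => f (gridPoint h r j i k w a b)) :=
  squareBeta_eq_gridForm f r h hh j i k w

theorem squareBeta_nonneg (f : ℝ × ℝ → ℝ) (r : ℕ) {h : ℝ} (hh : 0 < h) (j i : ℤ)
    (k w : ℕ) : 0 ≤ squareBeta f r h j i k w := by
  rw [squareBeta_eq_gridForm_gridPoint f r hh]
  exact mul_nonneg (by positivity) (gridForm_nonneg _ _ _ _)

section

variable {Ω Γ : Set (ℝ × ℝ)} {f : ℝ × ℝ → ℝ}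

theorem exists_squareBeta_le_of_disjoint (hΩ : IsOpen Ω) (hreg : IsRegularOff f Ω Γ)
    {r : ℕ} (hr : 2 ≤ r) {K : Set (ℝ × ℝ)} (hK : IsCompact K) (hKΩ : K ⊆ Ω) :
    ∃ C > 0, ∃ δ > 0, ∀ h : ℝ, 0 < h → h < δ → ∀ (j i : ℤ) (k w : ℕ), k < r → w < r →
      stencilBox r h j i k w ⊆ K → Γ ∩ stencilBox r h j i k w = ∅ →
        |squareBeta f r h j i k w| ≤ C * h ^ 2 := by
  obtain ⟨C, hC, hbound⟩ := exists_gridForm_le r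
  refine (exists_uniform_of_local hK r
    (fun c h j i k w => Γ ∩ stencilBox r h j i k w = ∅ →
      |squareBeta f r h j i k w| ≤ c⁻¹ * h ^ 2)
    (fun c c' h j i k w h0 hcc hP hΓ => (hP hΓ).trans
      (mul_le_mul_of_nonneg_right (inv_anti₀ h0 hcc) (sq_nonneg h))) ?_).elim
    fun c H => ⟨c⁻¹, inv_pos.2 H.1, c, H.1, H.2⟩
  intro p hp
  obtain ⟨H₁, H₂, -, -, hlim⟩ := exists_second_derivative_limits hΩ hreg (hKΩ hp)
  obtain ⟨ρ, hρ, hbox⟩ := hlim 1 one_pos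
  set M := 1 + max ‖H₁‖ ‖H₂‖ with hM
  have hM0 : 0 < M := by positivity
  have hr0 : (0 : ℝ) < r := by exact_mod_cast (by omega : 0 < r)
  refine ⟨(C * (M * r ^ 2) ^ 2)⁻¹, by positivity, ρ, hρ, fun h hh j i k w hk hw hb _ hΓ => ?_⟩
  obtain ⟨hC2, hD⟩ := hbox _ (convex_stencilBox h r j i k w).isPreconnected hb hΓ
  -- Comparison with `H = 0` puts the whole quadratic term into the remainder, which is enough for
  -- an upper bound.
  have hDM : ∀ x ∈ stencilBox r h j i k w,
      ‖fderiv ℝ (fderiv ℝ f) x - (0 : ℝ × ℝ →L[ℝ] ℝ × ℝ →L[ℝ] ℝ)‖ ≤ M := by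
    intro x hx
    refine le_of_eq_of_le (congrArg norm (sub_zero (fderiv ℝ (fderiv ℝ f) x))) ?_
    rcases hD with hD | hD
    · have h1 := norm_le_norm_sub_add (fderiv ℝ (fderiv ℝ f) x) H₁
      linarith [hD x hx, le_max_left ‖H₁‖ ‖H₂‖]
    · have h1 := norm_le_norm_sub_add (fderiv ℝ (fderiv ℝ f) x) H₂
      linarith [hD x hx, le_max_right ‖H₁‖ ‖H₂‖]
  obtain ⟨E, hE, he⟩ := gridForm_eq_quadData_add hr hh (fun _ _ => by simp) hC2 hDM
  have h2 := hbound k hk w hw (fun a b => h ^ 2 * quadData 0 a b + E a b) (M * (r * h) ^ 2)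
    (fun a ha b hb => by simpa [quadData] using hE a ha b hb)
  rw [abs_of_nonneg (squareBeta_nonneg f r hh j i k w), squareBeta_eq_gridForm_gridPoint f r hh, he,
    inv_inv]
  calc _ ≤ (h ^ 2)⁻¹ * (C * (M * (r * h) ^ 2) ^ 2) := mul_le_mul_of_nonneg_left h2 (by positivity)
    _ = _ := by field_simp

theorem exists_le_squareBeta_of_disjoint (hΩ : IsOpen Ω) (hreg : IsRegularOff f Ω Γ)
    {r : ℕ} (hr : 2 ≤ r) {K : Set (ℝ × ℝ)} (hK : IsCompact K) (hKΩ : K ⊆ Ω) {μ : ℝ}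
    (hμ : 0 < μ) :
    ∃ c > 0, ∃ δ > 0, ∀ h : ℝ, 0 < h → h < δ →
      ∀ (j i : ℤ) (k w : ℕ), k < r → w < r → stencilBox r h j i k w ⊆ K →
        Γ ∩ stencilBox r h j i k w = ∅ →
        (∀ p ∈ stencilBox r h j i k w, μ ≤ ‖fderiv ℝ (fderiv ℝ f) p‖) →
          c * h ^ 2 ≤ squareBeta f r h j i k w := by
  obtain ⟨C, hC, hbound⟩ := exists_gridForm_le r
  refine (exists_uniform_of_local hK r
    (fun c h j i k w => Γ ∩ stencilBox r h j i k w = ∅ →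
      (∀ p ∈ stencilBox r h j i k w, μ ≤ ‖fderiv ℝ (fderiv ℝ f) p‖) →
      c * h ^ 2 ≤ squareBeta f r h j i k w)
    (fun c c' h j i k w h0 hcc hP hΓ hd => (mul_le_mul_of_nonneg_right hcc (sq_nonneg h)).trans
      (hP hΓ hd)) ?_).elim
    fun c H => ⟨c, H.1, c, H.1, H.2⟩
  intro p hp
  obtain ⟨H₁, H₂, hs₁, hs₂, hlim⟩ := exists_second_derivative_limits hΩ hreg (hKΩ hp)
  have hr0 : (0 : ℝ) < r := by exact_mod_cast (by omega : 0 < r)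
  have hpos : ∀ H : ℝ × ℝ →L[ℝ] ℝ × ℝ →L[ℝ] ℝ, (∀ u v, H u v = H v u) →
      ∃ m > 0, H ≠ 0 → ∀ k < r, ∀ w < r, m ≤ gridForm r k w (quadData H) := by
    intro H hs
    by_cases hH : H = 0
    · exact ⟨1, one_pos, fun h => absurd hH h⟩
    obtain ⟨m, hm, hle⟩ := exists_le_gridForm (X := Unit) isCompact_univ r hr
      (fun _ => quadData H) (fun _ _ => continuous_const)
      (fun _ _ => not_affine_quadData hr hs hH)
    exact ⟨m, hm, fun _ k hk w hw => hle k hk w hw () trivial⟩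
  obtain ⟨m₁, hm₁, hle₁⟩ := hpos H₁ hs₁
  obtain ⟨m₂, hm₂, hle₂⟩ := hpos H₂ hs₂
  set m := min m₁ m₂ with hm
  have hm0 : 0 < m := lt_min hm₁ hm₂
  -- The first bound excludes `H = 0` where `‖D²f‖ ≥ μ`. The second keeps the error below `m / 4`,
  -- leaving `m / 2 - m / 4`.
  set η := min (μ / 2) (√(m / (4 * (C * r ^ 4)))) with hη
  have hη0 : 0 < η := lt_min (half_pos hμ) (Real.sqrt_pos.2 (by positivity))
  have hηm : C * r ^ 4 * η ^ 2 ≤ m / 4 := by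
    have h1 : η ^ 2 ≤ m / (4 * (C * r ^ 4)) :=
      (pow_le_pow_left₀ hη0.le (min_le_right _ _) 2).trans_eq (Real.sq_sqrt (by positivity))
    rw [le_div_iff₀ (by positivity)] at h1
    linarith
  obtain ⟨ρ, hρ, hbox⟩ := hlim η hη0
  refine ⟨m / 4, by positivity, ρ, hρ, fun h hh j i k w hk hw hb _ hΓ hd => ?_⟩
  obtain ⟨hC2, hD⟩ := hbox _ (convex_stencilBox h r j i k w).isPreconnected hb hΓ
  have key : ∀ H : ℝ × ℝ →L[ℝ] ℝ × ℝ →L[ℝ] ℝ, (∀ u v, H u v = H v u) →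
      (H ≠ 0 → ∀ k < r, ∀ w < r, m ≤ gridForm r k w (quadData H)) →
      (∀ x ∈ stencilBox r h j i k w, ‖fderiv ℝ (fderiv ℝ f) x - H‖ ≤ η) →
      m / 4 * h ^ 2 ≤ squareBeta f r h j i k w := by
    intro H hs hle hDH
    have hH : H ≠ 0 := by
      rintro rfl
      have hq := gridPoint_mem_stencilBox hh j i k w r.zero_le r.zero_le
      have h1 : ‖fderiv ℝ (fderiv ℝ f) _‖ ≤ η :=
        le_of_eq_of_le (congrArg norm (sub_zero (fderiv ℝ (fderiv ℝ f) _)).symm) (hDH _ hq)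
      linarith [hd _ hq, min_le_left (μ / 2) (√(m / (4 * (C * r ^ 4))))]
    obtain ⟨E, hE, he⟩ := gridForm_eq_quadData_add hr hh hs hC2 hDH
    have h1 := half_gridForm_sub_le r k w (fun a b => h ^ 2 * quadData H a b) E
    rw [gridForm_mul_left] at h1
    have h2 := hbound k hk w hw E _ hE
    have h3 := mul_le_mul_of_nonneg_left (hle hH k hk w hw) (sq_nonneg (h ^ 2))
    have h4 : C * (η * (r * h) ^ 2) ^ 2 ≤ m / 4 * h ^ 4 := by
      calc _ = (C * r ^ 4 * η ^ 2) * h ^ 4 := by ring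
        _ ≤ _ := mul_le_mul_of_nonneg_right hηm (by positivity)
    have h5 : m / 4 * h ^ 4 ≤ gridForm r k w (fun a b => h ^ 2 * quadData H a b + E a b) := by
      have : (h ^ 2) ^ 2 * m = m * h ^ 4 := by ring
      linarith
    rw [squareBeta_eq_gridForm_gridPoint f r hh, he]
    calc _ = (h ^ 2)⁻¹ * (m / 4 * h ^ 4) := by field_simp
      _ ≤ _ := mul_le_mul_of_nonneg_left h5 (by positivity)
  rcases hD with hD | hD
  · exact key H₁ hs₁ (fun h0 k hk w hw => (min_le_left _ _).trans (hle₁ h0 k hk w hw)) hD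
  · exact key H₂ hs₂ (fun h0 k hk w hw => (min_le_right _ _).trans (hle₂ h0 k hk w hw)) hD

theorem exists_le_norm_of_disjoint (hreg : IsRegularOff f Ω Γ)
    (hnonnull : ∀ p ∈ Ω \ Γ, fderiv ℝ (fderiv ℝ f) p ≠ 0) {K : Set (ℝ × ℝ)} (hK : IsCompact K)
    (hKΩ : K ⊆ Ω) (hKΓ : K ∩ Γ = ∅) : ∃ μ > 0, ∀ p ∈ K, μ ≤ ‖fderiv ℝ (fderiv ℝ f) p‖ := by
  rcases K.eq_empty_or_nonempty with rfl | hne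
  · exact ⟨1, one_pos, by simp⟩
  have hoff : ∀ p ∈ K, p ∈ Ω \ Γ := fun p hp =>
    ⟨hKΩ hp, fun hpΓ => (hKΓ ▸ ⟨hp, hpΓ⟩ : p ∈ (∅ : Set (ℝ × ℝ)))⟩
  have hcont : ContinuousOn (fun p => ‖fderiv ℝ (fderiv ℝ f) p‖) K := fun p hp =>
    (((hreg.1 p (hoff p hp)).fderiv_right (m := 1) le_rfl).fderiv_right (m := 0)
      (by norm_num)).continuousAt.norm.continuousWithinAt
  obtain ⟨q, hq, hmin⟩ := hK.exists_isMinOn hne hcont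
  exact ⟨_, (norm_pos_iff (a := fderiv ℝ (fderiv ℝ f) q)).2 (hnonnull q (hoff q hq)), fun p hp => hmin hp⟩

/-- Near a point of `Ω` off `Γ` there are no boxes which meet `Γ`; near a point of `Γ` the function
has a kink. -/
theorem exists_ball_disjoint_or_kink (hΩ : IsOpen Ω) (hf : ContinuousOn f Ω)
    (hsing : IsSingularityCurve f Γ) (hreg : IsRegularOff f Ω Γ) {p : ℝ × ℝ} (hp : p ∈ Ω) :
    (∃ ρ > 0, ∀ x ∈ Metric.ball p ρ, x ∉ Γ) ∨
    ∃ (n d : ℝ × ℝ →L[ℝ] ℝ) (c : ℝ), n ≠ 0 ∧ c ≠ 0 ∧ ∀ η > 0, ∃ ρ > 0,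
      ∀ ζ ∈ Γ, ζ ∈ Metric.ball p ρ → ∀ x ∈ Metric.ball p ρ,
        |f x - f ζ - d (x - ζ) - c * max 0 (n (x - ζ))| ≤ η * ‖x - ζ‖ := by
  by_cases hpΓ : p ∈ Γ
  · refine Or.inr (hsing.exists_kink hpΓ ?_)
    filter_upwards [hΩ.mem_nhds hp] with x hx using hf.continuousAt (hΩ.mem_nhds hx)
  · exact Or.inl (Metric.eventually_nhds_iff_ball.1
      (hsing.eventually_notMem (hreg.1 p ⟨hp, hpΓ⟩)))

theorem exists_squareBeta_le_of_meets (hΩ : IsOpen Ω) (hf : ContinuousOn f Ω)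
    (hsing : IsSingularityCurve f Γ) (hreg : IsRegularOff f Ω Γ)
    {r : ℕ} (hr : 2 ≤ r) {K : Set (ℝ × ℝ)} (hK : IsCompact K) (hKΩ : K ⊆ Ω) :
    ∃ C > 0, ∃ δ > 0, ∀ h : ℝ, 0 < h → h < δ → ∀ (j i : ℤ) (k w : ℕ), k < r → w < r →
      stencilBox r h j i k w ⊆ K → (Γ ∩ stencilBox r h j i k w).Nonempty →
        |squareBeta f r h j i k w| ≤ C := by
  obtain ⟨C, hC, hbound⟩ := exists_gridForm_le r
  refine (exists_uniform_of_local hK r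
    (fun c h j i k w => (Γ ∩ stencilBox r h j i k w).Nonempty →
      |squareBeta f r h j i k w| ≤ c⁻¹)
    (fun c c' h j i k w h0 hcc hP hΓ => (hP hΓ).trans (inv_anti₀ h0 hcc)) ?_).elim
    fun c H => ⟨c⁻¹, inv_pos.2 H.1, c, H.1, H.2⟩
  intro p hp
  rcases exists_ball_disjoint_or_kink hΩ hf hsing hreg (hKΩ hp) with
    ⟨ρ, hρ, hno⟩ | ⟨n, d, c, -, -, hkink⟩
  · refine ⟨1, one_pos, ρ, hρ, fun h hh j i k w hk hw hb _ ⟨ζ, hζ, hζb⟩ => ?_⟩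
    exact absurd hζ (hno ζ (hb hζb))
  obtain ⟨ρ, hρ, hest⟩ := hkink 1 one_pos
  have hr0 : (0 : ℝ) < r := by exact_mod_cast (by omega : 0 < r)
  -- In units of `h`, the kink contributes at most `|c| * ‖n‖ * r` and the error at most `r`.
  set M := (|c| * ‖n‖ + 1) * r with hM
  have hM0 : 0 < M := by positivity
  refine ⟨(C * M ^ 2)⁻¹, by positivity, ρ, hρ, fun h hh j i k w hk hw hb _ ⟨ζ, hζ, hζb⟩ => ?_⟩
  obtain ⟨E, hE, he⟩ := gridForm_eq_kinkData_add hr hh zero_le_one hζb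
    (fun x hx => hest ζ hζ (hb hζb) x (hb hx))
  have h2 := hbound k hk w hw (fun a b =>
    c * h * kinkData n (h⁻¹ • (ζ - gridPoint h r j i k w 0 0)) a b + E a b) (M * h) (fun a ha b hb' => by
    have hk1 : |kinkData n (h⁻¹ • (ζ - gridPoint h r j i k w 0 0)) a b| ≤ ‖n‖ * r := by
      have e : (((a : ℝ), (b : ℝ)) - h⁻¹ • (ζ - gridPoint h r j i k w 0 0) : ℝ × ℝ) =
          h⁻¹ • (gridPoint h r j i k w a b - ζ) := by
        rw [gridPoint_eq h r j i k w a b, add_comm, ← sub_sub_eq_add_sub, smul_sub h⁻¹ (h • _),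
          inv_smul_smul₀ hh.ne']
      have h3 : ‖(((a : ℝ), (b : ℝ)) - h⁻¹ • (ζ - gridPoint h r j i k w 0 0) : ℝ × ℝ)‖ ≤ r := by
        rw [e, norm_smul, norm_inv, Real.norm_of_nonneg hh.le, inv_mul_le_iff₀ hh, mul_comm]
        exact norm_sub_le_of_mem_stencilBox (gridPoint_mem_stencilBox hh j i k w ha hb') hζb
      rw [kinkData, abs_of_nonneg (le_max_left _ _)]
      exact max_le (by positivity) ((le_abs_self _).trans ((n.le_opNorm _).trans
        (mul_le_mul_of_nonneg_left h3 (norm_nonneg n))))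
    have h4 := mul_le_mul_of_nonneg_left hk1 (show 0 ≤ |c| * h by positivity)
    refine (abs_add_le _ _).trans ?_
    rw [abs_mul, abs_mul, abs_of_pos hh, hM]
    linarith [hE a ha b hb'])
  rw [abs_of_nonneg (squareBeta_nonneg f r hh j i k w), squareBeta_eq_gridForm_gridPoint f r hh, he,
    inv_inv]
  calc _ ≤ (h ^ 2)⁻¹ * (C * (M * h) ^ 2) := mul_le_mul_of_nonneg_left h2 (by positivity)
    _ = _ := by field_simp

theorem exists_le_squareBeta_of_meets (hΩ : IsOpen Ω) (hf : ContinuousOn f Ω)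
    (hsing : IsSingularityCurve f Γ) (hreg : IsRegularOff f Ω Γ)
    {r : ℕ} (hr : 2 ≤ r) {K : Set (ℝ × ℝ)} (hK : IsCompact K) (hKΩ : K ⊆ Ω) {ε : ℝ}
    (hε : 0 < ε) :
    ∃ c > 0, ∃ δ > 0, ∀ h : ℝ, 0 < h → h < δ →
      ∀ (j i : ℤ) (k w : ℕ), k < r → w < r → stencilBox r h j i k w ⊆ K →
        (∃ ξ ∈ Γ, Metric.closedBall ξ (ε * h) ⊆ stencilBox r h j i k w) →
          c ≤ squareBeta f r h j i k w := by
  obtain ⟨C, hC, hbound⟩ := exists_gridForm_le r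
  refine (exists_uniform_of_local hK r
    (fun c h j i k w => (∃ ξ ∈ Γ, Metric.closedBall ξ (ε * h) ⊆ stencilBox r h j i k w) →
      c ≤ squareBeta f r h j i k w)
    (fun c c' h j i k w h0 hcc hP hΓ => hcc.trans (hP hΓ)) ?_).elim
    fun c H => ⟨c, H.1, c, H.1, H.2⟩
  intro p hp
  rcases exists_ball_disjoint_or_kink hΩ hf hsing hreg (hKΩ hp) with
    ⟨ρ, hρ, hno⟩ | ⟨n, d, c, hn, hc0, hkink⟩
  · refine ⟨1, one_pos, ρ, hρ, fun h hh j i k w hk hw hb _ ⟨ζ, hζ, hζb⟩ => ?_⟩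
    exact absurd hζ (hno ζ (hb (hζb (Metric.mem_closedBall_self (by positivity)))))
  have hr0 : (0 : ℝ) < r := by exact_mod_cast (by omega : 0 < r)
  -- The centre of the kink ranges over a compact square inside the open box, where the data are
  -- never affine.
  obtain ⟨m, hm, hle⟩ := exists_le_gridForm
    (isCompact_Icc.prod isCompact_Icc : IsCompact (Icc ε (r - ε) ×ˢ Icc ε (r - ε))) r hr
    (kinkData n) (fun a b => by unfold kinkData; fun_prop)
    (fun z hz => not_affine_kinkData hr hn
      ⟨hε.trans_le hz.1.1, by linarith [hz.1.2]⟩ ⟨hε.trans_le hz.2.1, by linarith [hz.2.2]⟩)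
  set η := √(c ^ 2 * m / (4 * (C * r ^ 2))) with hη
  have hη0 : 0 < η := Real.sqrt_pos.2 (by positivity)
  have hηm : C * r ^ 2 * η ^ 2 = c ^ 2 * m / 4 := by
    rw [hη, Real.sq_sqrt (by positivity)]
    field_simp
  obtain ⟨ρ, hρ, hest⟩ := hkink η hη0
  refine ⟨c ^ 2 * m / 4, by positivity, ρ, hρ, fun h hh j i k w hk hw hb _ ⟨ζ, hζ, hζc⟩ => ?_⟩
  have hζb : ζ ∈ stencilBox r h j i k w := hζc (Metric.mem_closedBall_self (by positivity))
  obtain ⟨E, hE, he⟩ := gridForm_eq_kinkData_add hr hh hη0.le hζb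
    (fun x hx => hest ζ hζ (hb hζb) x (hb hx))
  set q := gridPoint h r j i k w 0 0 with hq
  -- The norm is the maximum norm, so the two corners `ζ ± (ε * h, ε * h)` of the closed ball lie in
  -- the box and give all four inequalities.
  have hz : h⁻¹ • (ζ - q) ∈ Icc ε (r - ε) ×ˢ Icc ε (r - ε) := by
    have hεh : 0 < ε * h := by positivity
    have m1 := mem_stencilBox_iff.1 (hζc (show ζ - (ε * h, ε * h) ∈ _ by
      simp [Prod.norm_def, abs_of_pos hε, abs_of_pos hh]))
    have m2 := mem_stencilBox_iff.1 (hζc (show ζ + (ε * h, ε * h) ∈ _ by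
      simp [Prod.norm_def, abs_of_pos hε, abs_of_pos hh]))
    rw [← hq] at m1 m2
    simp only [Prod.fst_sub, Prod.snd_sub, Prod.fst_add, Prod.snd_add] at m1 m2
    simp only [mem_prod, mem_Icc, Prod.smul_fst, Prod.smul_snd, Prod.fst_sub, Prod.snd_sub,
      smul_eq_mul, inv_mul_eq_div, le_div_iff₀ hh, div_le_iff₀ hh, sub_mul]
    refine ⟨⟨?_, ?_⟩, ?_, ?_⟩ <;> linarith [m1.1.1, m1.2.1, m2.1.2, m2.2.2]
  have h1 := half_gridForm_sub_le r k w (fun a b => c * h * kinkData n (h⁻¹ • (ζ - q)) a b) E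
  rw [gridForm_mul_left] at h1
  have h2 := hbound k hk w hw E _ hE
  have h3 := mul_le_mul_of_nonneg_left (hle k hk w hw _ hz) (sq_nonneg (c * h))
  have h4 : C * (η * (r * h)) ^ 2 = c ^ 2 * m / 4 * h ^ 2 := by
    rw [← hηm]; ring
  have h5 : c ^ 2 * m / 4 * h ^ 2 ≤ gridForm r k w
      (fun a b => c * h * kinkData n (h⁻¹ • (ζ - q)) a b + E a b) := by
    have : (c * h) ^ 2 * m = c ^ 2 * m * h ^ 2 := by ring
    linarith
  rw [squareBeta_eq_gridForm_gridPoint f r hh, he]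
  calc _ = (h ^ 2)⁻¹ * (c ^ 2 * m / 4 * h ^ 2) := by field_simp
    _ ≤ _ := mul_le_mul_of_nonneg_left h5 (by positivity)

end

theorem proposition2p1 (Ω Γ : Set (ℝ × ℝ)) (f : ℝ × ℝ → ℝ)
    (hΩ : IsOpen Ω) (hΓΩ : Γ ⊆ Ω) (hf : ContinuousOn f Ω)
    (hsing : IsSingularityCurve f Γ) (hreg : IsRegularOff f Ω Γ)
    -- at every point off `Γ` some second derivative of `f` is not zero
    (hnonnull : ∀ p ∈ Ω \ Γ, fderiv ℝ (fderiv ℝ f) p ≠ 0)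
    (r : ℕ) (hr : 1 < r) (K : Set (ℝ × ℝ)) (hK : IsCompact K) (hKΩ : K ⊆ Ω) :
    -- (i) the upper bound of order `Δ²`, if `Γ` misses the closed stencil box
    (∃ C > 0, ∃ δ > 0, ∀ h : ℝ, 0 < h → h < δ → ∀ (j i : ℤ) (k w : ℕ), k < r → w < r →
      stencilBox r h j i k w ⊆ K → Γ ∩ stencilBox r h j i k w = ∅ →
        |squareBeta f r h j i k w| ≤ C * h ^ 2) ∧
    -- (i) the order is exactly `Δ²`: away from `Γ`, ...
    (K ∩ Γ = ∅ → ∃ c > 0, ∃ δ > 0, ∀ h : ℝ, 0 < h → h < δ →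
      ∀ (j i : ℤ) (k w : ℕ), k < r → w < r → stencilBox r h j i k w ⊆ K →
        c * h ^ 2 ≤ squareBeta f r h j i k w) ∧
    -- ... and up to `Γ`, where the second derivatives do not degenerate
    (∀ μ > 0, ∃ c > 0, ∃ δ > 0, ∀ h : ℝ, 0 < h → h < δ →
      ∀ (j i : ℤ) (k w : ℕ), k < r → w < r → stencilBox r h j i k w ⊆ K →
        Γ ∩ stencilBox r h j i k w = ∅ →
        (∀ p ∈ stencilBox r h j i k w, μ ≤ ‖fderiv ℝ (fderiv ℝ f) p‖) →
          c * h ^ 2 ≤ squareBeta f r h j i k w) ∧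
    -- (ii) the upper bound of order one, if `Γ` meets the closed stencil box
    (∃ C > 0, ∃ δ > 0, ∀ h : ℝ, 0 < h → h < δ → ∀ (j i : ℤ) (k w : ℕ), k < r → w < r →
      stencilBox r h j i k w ⊆ K → (Γ ∩ stencilBox r h j i k w).Nonempty →
        |squareBeta f r h j i k w| ≤ C) ∧
    -- (ii) it is exactly of order one (bounded below by a positive constant), if `Γ` does not
    -- merely graze the boundary of the box
    (∀ ε > 0, ∃ c > 0, ∃ δ > 0, ∀ h : ℝ, 0 < h → h < δ →
      ∀ (j i : ℤ) (k w : ℕ), k < r → w < r → stencilBox r h j i k w ⊆ K →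
        (∃ ξ ∈ Γ, Metric.closedBall ξ (ε * h) ⊆ stencilBox r h j i k w) →
          c ≤ squareBeta f r h j i k w) := by
  refine ⟨exists_squareBeta_le_of_disjoint hΩ hreg hr hK hKΩ, fun hKΓ => ?_,
    fun μ hμ => exists_le_squareBeta_of_disjoint hΩ hreg hr hK hKΩ hμ,
    exists_squareBeta_le_of_meets hΩ hf hsing hreg hr hK hKΩ,
    fun ε hε => exists_le_squareBeta_of_meets hΩ hf hsing hreg hr hK hKΩ hε⟩
  obtain ⟨μ, hμ, hle⟩ := exists_le_norm_of_disjoint hreg hnonnull hK hKΩ hKΓ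
  obtain ⟨c, hc, δ, hδ, H⟩ := exists_le_squareBeta_of_disjoint hΩ hreg hr hK hKΩ hμ
  refine ⟨c, hc, δ, hδ, fun h h0 hh j i k w hk hw hb => H h h0 hh j i k w hk hw hb ?_
    fun p hp => hle p (hb hp)⟩
  rw [← subset_empty_iff, ← hKΓ]
  exact fun x hx => ⟨hb hx.2, hx.1⟩
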